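/- Let $G$ be a finite group, $\mathcal{O}$ an indexing system for $G$, and $\varphi\colon \underline{A}\to\underline{B}$ a map of $\mathcal{O}$-Tambara functors. Let $\underline{A}\text{-}\mathsf{CAlg}/\underline{B}$ be the category of factorizations $\underline{A}\to\underline{R}\xrightarrow{\varepsilon}\underline{B}$ of $\varphi$ in $\mathcal{O}$-Tambara functors, and let $(\underline{A}\text{-}\mathsf{CAlg}/\underline{B})_{ab}$ be its category of abelian group objects. A map $f\colon X\to Y$ of finite $G$-sets is called 2-surjective if each fibre $f^{-1}(y)$, $y\in Y$, has at least two elements. Let $\mathsf{D}$ be the full subcategory of those $\underline{R}\in(\underline{A}\text{-}\mathsf{CAlg}/\underline{B})_{ab}$ for which $N_f(r)=0$ for every $\mathcal{O}$-admissible 2-surjective $f\colon X\to Y$ and every $r\in\ker(\varepsilon\colon\underline{R}(X)\to\underline{B}(X))$. Then the augmentation ideal functor $\underline{R}\mapsto\ker(\underline{R}\to\underline{B})$, where $\underline{B}$ acts on the kernel through the unit $\underline{B}\to\underline{R}$ of the group object, is an equivalence from $\mathsf{D}$ to the category of $\underline{B}$-modules. An inverse is the square-zero extension $\underline{M}\mapsto\underline{B}\ltimes\underline{M}$.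 Here $(\underline{B}\ltimes\underline{M})(X)=\underline{B}(X)\oplus\underline{M}(X)$, with componentwise addition, restrictions and transfers, product $(b,m)(b',m')=(bb',\,bm'+b'm)$, unit element $(1,0)$, and norms $$N_f(b,m)=\bigl(N_f(b),\;T_f\bigl(N_{\pi_1}R_{\pi_2}(b)\cdot m\bigr)\bigr)$$ for $\mathcal{O}$-admissible $f\colon X\to Y$, where $\pi_1,\pi_2\colon X\times_Y X-\Delta(X)\to X$ are the projections. The structure maps are $\underline{A}\to\underline{B}\ltimes\underline{M}$, $a\mapsto(\varphi(a),0)$, and $\underline{B}\ltimes\underline{M}\to\underline{B}$, $(b,m)\mapsto b$. The group structure has unit $b\mapsto(b,0)$, addition $((b,m),(b,m'))\mapsto(b,m+m')$ and inverse $(b,m)\mapsto(b,-m)$. On morphisms, $g\colon\underline{M}\to\underline{M}'$ goes to $(b,m)\mapsto(b,g(m))$. -/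

import Mathlib

open CategoryTheory

universe u v

/-! ### Finite `G`-sets -/

/-- A finite `G`-set. -/
structure FinGSet (G : Type u) [Group G] : Type (u + 1) where
  carrier : Type u
  [action : MulAction G carrier]
  [finite : Finite carrier]

namespace FinGSet

instance (G : Type u) [Group G] : CoeSort (FinGSet G) (Type u) := ⟨carrier⟩

attribute [instance] FinGSet.action FinGSet.finite

variable {G : Type u} [Group G]

/-- Equivariant maps of finite `G`-sets. -/
abbrev Hom (X Y : FinGSet.{u} G) : Type u := X →[G] Y

/-- The disjoint union of two finite `G`-sets. -/
def sum (X Y : FinGSet.{u} G) : FinGSet.{u} G := ⟨X ⊕ Y⟩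

/-- The product of two finite `G`-sets, with the diagonal action. -/
def prod (X Y : FinGSet.{u} G) : FinGSet.{u} G := ⟨X × Y⟩

/-- The first inclusion `X → X ⊔ Y`. -/
def inl (X Y : FinGSet.{u} G) : X.Hom (X.sum Y) where
  toFun := Sum.inl
  map_smul' _ _ := rfl

/-- The second inclusion `Y → X ⊔ Y`. -/
def inr (X Y : FinGSet.{u} G) : Y.Hom (X.sum Y) where
  toFun := Sum.inr
  map_smul' _ _ := rfl

/-- The sub-`G`-set of `X` given by an invariant predicate. -/
def sub (X : FinGSet.{u} G) (p : X → Prop) (hp : ∀ (g : G) (x : X), p x → p (g • x)) :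
    FinGSet.{u} G :=
  letI : MulAction G {x : X // p x} :=
    { smul := fun g x => ⟨g • x.1, hp g x.1 x.2⟩
      one_smul := fun x => Subtype.ext (one_smul G x.1)
      mul_smul := fun g h x => Subtype.ext (mul_smul g h x.1) }
  ⟨{x : X // p x}⟩

/-- The equalizer of two equivariant maps. -/
def equalizer {X Y : FinGSet.{u} G} (f g : X.Hom Y) : FinGSet.{u} G :=
  X.sub (fun x => f x = g x) (fun γ x h => by rw [map_smul, map_smul, h])

/-- The fibre product `X ×_Y Z`. -/
def fiberProd {X Y Z : FinGSet.{u} G} (f : X.Hom Y) (g : Z.Hom Y) : FinGSet.{u} G :=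
  (X.prod Z).sub (fun p => f p.1 = g p.2)
    (fun γ p h => by
      change f (γ • p.1) = g (γ • p.2)
      rw [map_smul, map_smul, h])

/-- The complement `X ×_Y X - Δ(X)` of the diagonal in the fibre product of `f : X → Y` with
itself. -/
def offDiag {X Y : FinGSet.{u} G} (f : X.Hom Y) : FinGSet.{u} G :=
  (X.prod X).sub (fun p => f p.1 = f p.2 ∧ p.1 ≠ p.2)
    (fun γ p h => by
      refine ⟨?_, fun h' => h.2 (MulAction.injective γ h')⟩
      change f (γ • p.1) = f (γ • p.2)
      rw [map_smul, map_smul, h.1])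

/-- The first projection `X ×_Y X - Δ(X) → X`. -/
def offDiagFst {X Y : FinGSet.{u} G} (f : X.Hom Y) : (offDiag f).Hom X where
  toFun p := p.1.1
  map_smul' _ _ := rfl

/-- The second projection `X ×_Y X - Δ(X) → X`. -/
def offDiagSnd {X Y : FinGSet.{u} G} (f : X.Hom Y) : (offDiag f).Hom X where
  toFun p := p.1.2
  map_smul' _ _ := rfl

/-- The commutative square
```
  P --p--> X
  |        |
  q        f
  v        v
  Z --g--> Y
```
of finite `G`-sets is a pullback square. -/
structure IsCartesian {P X Y Z : FinGSet.{u} G} (p : P.Hom X) (q : P.Hom Z) (f : X.Hom Y)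
    (g : Z.Hom Y) : Prop where
  comm : ∀ w : P, f (p w) = g (q w)
  existsUnique : ∀ (x : X) (z : Z), f x = g z → ∃! w : P, p w = x ∧ q w = z

/-- `f : X → Y` is 2-surjective: each fibre `f⁻¹(y)`, `y ∈ Y`, has at least two elements. -/
def TwoSurjective {X Y : FinGSet.{u} G} (f : X.Hom Y) : Prop :=
  ∀ y : Y, (f ⁻¹' {y}).Nontrivial

/-! ### Exponential diagrams -/

/-- An element of `∏_g A` for `A --h--> X --g--> Y`: a point `y` of `Y` together with a section
of `h` over the fibre `g⁻¹(y)`. -/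
structure DepProdElt {A X Y : FinGSet.{u} G} (h : A.Hom X) (g : X.Hom Y) : Type u where
  base : Y
  sec : ∀ x : X, g x = base → A
  isSection : ∀ (x : X) (hx : g x = base), h (sec x hx) = x

theorem DepProdElt.ext' {A X Y : FinGSet.{u} G} {h : A.Hom X} {g : X.Hom Y}
    {s t : DepProdElt h g} (hb : s.base = t.base)
    (hs : ∀ (x : X) (hx : g x = s.base) (hx' : g x = t.base), s.sec x hx = t.sec x hx') :
    s = t := by
  obtain ⟨b, s, _⟩ := s
  obtain ⟨c, t, _⟩ := t
  obtain rfl : b = c := hb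
  obtain rfl : s = t := funext fun x => funext fun hx => hs x hx hx
  rfl

/-- `G` acts on `∏_g A` by translating the base point and conjugating the section. -/
instance {A X Y : FinGSet.{u} G} (h : A.Hom X) (g : X.Hom Y) : MulAction G (DepProdElt h g) where
  smul γ s :=
    { base := γ • s.base
      sec := fun x hx => γ • s.sec (γ⁻¹ • x) (by rw [map_smul, hx, inv_smul_smul])
      isSection := fun x hx => by rw [map_smul, s.isSection, smul_inv_smul] }
  one_smul s := by
    refine DepProdElt.ext' (one_smul G s.base) fun x hx hx' => ?_
    change (1 : G) • s.sec ((1 : G)⁻¹ • x) _ = _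
    simp only [one_smul, inv_one]
  mul_smul γ δ s := by
    refine DepProdElt.ext' (mul_smul γ δ s.base) fun x hx hx' => ?_
    change (γ * δ) • s.sec ((γ * δ)⁻¹ • x) _ = γ • δ • s.sec (δ⁻¹ • γ⁻¹ • x) _
    simp only [mul_smul, mul_inv_rev]

instance {A X Y : FinGSet.{u} G} (h : A.Hom X) (g : X.Hom Y) : Finite (DepProdElt h g) := by
  let F : DepProdElt h g → (y : Y) × ({x : X // g x = y} → A) :=
    fun s => ⟨s.base, fun x => s.sec x.1 x.2⟩
  refine Finite.of_injective F ?_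
  rintro ⟨b, s, _⟩ ⟨c, t, _⟩ hst
  obtain rfl : b = c := congrArg Sigma.fst hst
  have h2 := eq_of_heq (Sigma.mk.inj hst).2
  exact DepProdElt.ext' rfl fun x hx _ => congrFun h2 ⟨x, hx⟩

/-- The dependent product `∏_g A`. -/
def depProd {A X Y : FinGSet.{u} G} (h : A.Hom X) (g : X.Hom Y) : FinGSet.{u} G :=
  ⟨DepProdElt h g⟩

/-- The map `h' : ∏_g A → Y`, `(y, s) ↦ y`. -/
def depProdBase {A X Y : FinGSet.{u} G} (h : A.Hom X) (g : X.Hom Y) : (depProd h g).Hom Y where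
  toFun s := s.base
  map_smul' _ _ := rfl

/-- The map `g' : X ×_Y ∏_g A → ∏_g A`, `(x, y, s) ↦ (y, s)`. -/
def depProdSnd {A X Y : FinGSet.{u} G} (h : A.Hom X) (g : X.Hom Y) :
    (fiberProd g (depProdBase h g)).Hom (depProd h g) where
  toFun p := p.1.2
  map_smul' _ _ := rfl

/-- The evaluation map `f' : X ×_Y ∏_g A → A`, `(x, y, s) ↦ s(x)`. -/
def depProdEval {A X Y : FinGSet.{u} G} (h : A.Hom X) (g : X.Hom Y) :
    (fiberProd g (depProdBase h g)).Hom A where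
  toFun p := p.1.2.sec p.1.1 p.2
  map_smul' γ p := by
    change γ • p.1.2.sec (γ⁻¹ • γ • p.1.1) _ = γ • p.1.2.sec p.1.1 _
    simp only [inv_smul_smul]

/-- The projection `X ×_Y ∏_g A → X`. -/
def depProdFst {A X Y : FinGSet.{u} G} (h : A.Hom X) (g : X.Hom Y) :
    (fiberProd g (depProdBase h g)).Hom X where
  toFun p := p.1.1
  map_smul' _ _ := rfl

theorem isCartesian_depProd {A X Y : FinGSet.{u} G} (h : A.Hom X) (g : X.Hom Y) :
    IsCartesian (depProdFst h g) (depProdSnd h g) g (depProdBase h g) where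
  comm := Subtype.property
  existsUnique x z hxz :=
    ⟨⟨(x, z), hxz⟩, ⟨rfl, rfl⟩, fun _ hw => Subtype.ext (Prod.ext hw.1 hw.2)⟩

/-! ### Orbits, restriction and induction -/

/-- The `H`-set `H/K` (for `K ≤ H`). -/
def orbit [Finite G] (H K : Subgroup G) : FinGSet.{u} H := ⟨H ⧸ K.subgroupOf H⟩

/-- The pullback of an `H`-set along the homomorphism `K → H`, `k ↦ g⁻¹kg`, where `g⁻¹Kg ≤ H`.
These are the restrictions along the maps `G/K → G/H`, `aK ↦ agH`, of the orbit category. -/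
def restrict {H K : Subgroup G} (g : G) (hg : ∀ k ∈ K, g⁻¹ * k * g ∈ H) (T : FinGSet.{u} H) :
    FinGSet.{u} K :=
  letI : MulAction K T :=
    { smul := fun k t => (⟨g⁻¹ * k * g, hg k k.2⟩ : H) • t
      one_smul := fun t => by
        have : (⟨g⁻¹ * ((1 : K) : G) * g, hg _ (1 : K).2⟩ : H) = 1 := Subtype.ext (by simp)
        change (⟨g⁻¹ * ((1 : K) : G) * g, hg _ (1 : K).2⟩ : H) • t = t
        rw [this, one_smul]
      mul_smul := fun k l t => by
        have : (⟨g⁻¹ * ((k * l : K) : G) * g, hg _ (k * l).2⟩ : H)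
            = ⟨g⁻¹ * k * g, hg k k.2⟩ * ⟨g⁻¹ * l * g, hg l l.2⟩ :=
          Subtype.ext (by simp [mul_assoc])
        change (⟨g⁻¹ * ((k * l : K) : G) * g, hg _ (k * l).2⟩ : H) • t = _
        rw [this, mul_smul]
        rfl }
  ⟨T⟩

/-- The equivalence relation on `H × T` generated by `(hk, t) ~ (h, kt)` for `k ∈ K`. -/
def inducedSetoid {H K : Subgroup G} (hKH : K ≤ H) (T : FinGSet.{u} K) : Setoid (H × T) where
  r p q := ∃ k : K, p.1 = q.1 * Subgroup.inclusion hKH k ∧ q.2 = k • p.2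
  iseqv :=
    { refl := fun p => ⟨1, by simp, by simp⟩
      symm := by
        rintro p q ⟨k, h1, h2⟩
        exact ⟨k⁻¹, by rw [h1, map_inv, mul_inv_cancel_right], by rw [h2, inv_smul_smul]⟩
      trans := by
        rintro p q r ⟨k, h1, h2⟩ ⟨l, h3, h4⟩
        exact ⟨l * k, by rw [h1, h3, map_mul, mul_assoc], by rw [h4, h2, mul_smul]⟩ }

/-- The induced `H`-set `H ×_K T`, with `H` acting on the left factor. -/
def induced [Finite G] {H K : Subgroup G} (hKH : K ≤ H) (T : FinGSet.{u} K) : FinGSet.{u} H :=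
  letI : MulAction H (Quotient (inducedSetoid hKH T)) :=
    { smul := fun a => Quotient.map (fun p => (a * p.1, p.2)) (by
        rintro p q ⟨k, h1, h2⟩
        exact ⟨k, by simp only [h1, mul_assoc], h2⟩)
      one_smul := by
        rintro ⟨p⟩
        exact congrArg (Quotient.mk _) (Prod.ext (one_mul p.1) rfl)
      mul_smul := by
        rintro a b ⟨p⟩
        exact congrArg (Quotient.mk _) (Prod.ext (mul_assoc a b p.1) rfl) }
  ⟨Quotient (inducedSetoid hKH T)⟩

end FinGSet

/-! ### Indexing systems -/

/-- An indexing system: a full, replete symmetric monoidal (for disjoint unions) subfunctor of the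
functor sending `G/H` to the category of finite `H`-sets, which contains the trivial sets and is
closed under finite limits and self-induction. The terminal object being trivial, finite limits
are given by binary products and equalizers. -/
structure IndexingSystem (G : Type u) [Group G] [Finite G] where
  /-- `mem H T` means `T ∈ O(G/H)`. -/
  mem : ∀ H : Subgroup G, FinGSet.{u} H → Prop
  mem_iff_of_iso : ∀ (H : Subgroup G) (S T : FinGSet.{u} H) (f : S.Hom T),
    Function.Bijective f → (mem H S ↔ mem H T)
  mem_restrict : ∀ (H K : Subgroup G) (g : G) (hg : ∀ k ∈ K, g⁻¹ * k * g ∈ H)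
    (T : FinGSet.{u} H), mem H T → mem K (T.restrict g hg)
  mem_sum : ∀ (H : Subgroup G) (S T : FinGSet.{u} H), mem H S → mem H T → mem H (S.sum T)
  mem_trivial : ∀ (H : Subgroup G) (T : FinGSet.{u} H), (∀ (h : H) (t : T), h • t = t) → mem H T
  mem_prod : ∀ (H : Subgroup G) (S T : FinGSet.{u} H), mem H S → mem H T → mem H (S.prod T)
  mem_equalizer : ∀ (H : Subgroup G) (S T : FinGSet.{u} H) (f g : S.Hom T),
    mem H S → mem H T → mem H (FinGSet.equalizer f g)
  mem_induced : ∀ (H K : Subgroup G) (hKH : K ≤ H) (T : FinGSet.{u} K),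
    mem H (FinGSet.orbit H K) → mem K T → mem H (T.induced hKH)

namespace IndexingSystem

variable {G : Type u} [Group G] [Finite G] (O : IndexingSystem G)

/-- `f : S → T` is `O`-admissible if `G_{f(s)}/G_s ∈ O(G/G_{f(s)})` for all `s ∈ S`. -/
def Admissible {S T : FinGSet.{u} G} (f : S.Hom T) : Prop :=
  ∀ s : S, O.mem (MulAction.stabilizer G (f s))
    (FinGSet.orbit (MulAction.stabilizer G (f s)) (MulAction.stabilizer G s))

theorem mem_sub (H : Subgroup G) (T : FinGSet.{u} H) (p : T → Prop)
    (hp : ∀ (h : H) (t : T), p t → p (h • t)) (hT : O.mem H T) : O.mem H (T.sub p hp) := by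
  classical
  let _ : MulAction H (ULift.{u} Prop) :=
    { smul := fun _ b => b
      one_smul := fun _ => rfl
      mul_smul := fun _ _ _ => rfl }
  let B : FinGSet.{u} H := ⟨ULift.{u} Prop⟩
  have hB : O.mem H B := O.mem_trivial H B fun _ _ => rfl
  let f : T.Hom B :=
    { toFun := fun t => ⟨p t⟩
      map_smul' := fun h t => by
        refine congrArg ULift.up (propext ⟨fun ht => ?_, hp h t⟩)
        have := hp h⁻¹ _ ht
        rwa [inv_smul_smul] at this }
  let g : T.Hom B :=
    { toFun := fun _ => ⟨True⟩
      map_smul' := fun _ _ => rfl }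
  have key := O.mem_equalizer H T B f g hT hB
  let e : (T.sub p hp).Hom (FinGSet.equalizer f g) :=
    { toFun := fun t => ⟨t.1, congrArg ULift.up (eq_true t.2)⟩
      map_smul' := fun _ _ => rfl }
  refine (O.mem_iff_of_iso H _ _ e ⟨?_, ?_⟩).2 key
  · intro a b hab
    exact Subtype.ext (congrArg (fun z => z.1) hab)
  · intro t
    exact ⟨⟨t.1, of_eq_true (congrArg ULift.down t.2)⟩, rfl⟩

theorem mem_orbit_of_mem (H L : Subgroup G) (T : FinGSet.{u} H) (hT : O.mem H T) (t : T)
    (hL : ∀ h : H, (h : G) ∈ L ↔ h • t = t) : O.mem H (FinGSet.orbit H L) := by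
  have hp : ∀ (h : H) (s : T), (∃ k : H, k • t = s) → ∃ k : H, k • t = h • s := by
    rintro h _ ⟨k, rfl⟩
    exact ⟨h * k, mul_smul h k t⟩
  have key := O.mem_sub H T (fun s => ∃ h : H, h • t = s) hp hT
  let F : H ⧸ L.subgroupOf H → {s : T // ∃ h : H, h • t = s} :=
    Quotient.lift (fun h : H => ⟨h • t, h, rfl⟩) (by
      intro a b hab
      have h1 : a⁻¹ * b ∈ L.subgroupOf H := QuotientGroup.leftRel_apply.1 hab
      have h2 := (hL _).1 (Subgroup.mem_subgroupOf.1 h1)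
      rw [mul_smul, inv_smul_eq_iff] at h2
      exact Subtype.ext h2.symm)
  let e : (FinGSet.orbit H L).Hom (T.sub (fun s => ∃ h : H, h • t = s) hp) :=
    { toFun := F
      map_smul' := by
        rintro h ⟨a⟩
        exact Subtype.ext (mul_smul h a t) }
  refine (O.mem_iff_of_iso H _ _ e ⟨?_, ?_⟩).2 key
  · rintro ⟨a⟩ ⟨b⟩ hab
    have h1 : a • t = b • t := congrArg Subtype.val hab
    refine Quotient.sound (QuotientGroup.leftRel_apply.2 ?_)
    refine Subgroup.mem_subgroupOf.2 ((hL _).2 ?_)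
    rw [mul_smul, inv_smul_eq_iff, h1]
  · rintro ⟨_, h, rfl⟩
    exact ⟨Quotient.mk _ h, rfl⟩

theorem admissible_id (O : IndexingSystem G) (X : FinGSet.{u} G) :
    O.Admissible (S := X) (T := X) (MulActionHom.id G) := by
  intro s
  refine O.mem_trivial _ _ ?_
  rintro h ⟨a⟩
  refine Quotient.sound (QuotientGroup.leftRel_apply.2 (Subgroup.mem_subgroupOf.2 ?_))
  exact SetLike.coe_mem _

/-- Admissible maps are closed under composition. -/
theorem Admissible.comp {O : IndexingSystem G} {X Y Z : FinGSet.{u} G} {f : X.Hom Y} {g : Y.Hom Z}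
    (hg : O.Admissible g) (hf : O.Admissible f) :
    O.Admissible (S := X) (T := Z) (MulActionHom.comp g f) := by
  intro s
  have hKH : MulAction.stabilizer G (f s) ≤ MulAction.stabilizer G (g (f s)) := by
    intro k hk
    rw [MulAction.mem_stabilizer_iff, ← map_smul, MulAction.mem_stabilizer_iff.1 hk]
  refine O.mem_orbit_of_mem _ _ _ (O.mem_induced _ _ hKH _ (hg (f s)) (hf s))
    (Quotient.mk (FinGSet.inducedSetoid hKH _) (1, QuotientGroup.mk 1)) fun h => ?_
  change _ ↔ Quotient.mk (FinGSet.inducedSetoid hKH _) (h * 1, _) = _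
  rw [Quotient.eq]
  constructor
  · intro hs
    have hfs : (h : G) ∈ MulAction.stabilizer G (f s) := by
      rw [MulAction.mem_stabilizer_iff, ← map_smul, MulAction.mem_stabilizer_iff.1 hs]
    refine ⟨⟨h, hfs⟩, Subtype.ext (by simp), ?_⟩
    refine QuotientGroup.eq.2 (Subgroup.mem_subgroupOf.2 ?_)
    simpa using hs
  · rintro ⟨k, h1, h2⟩
    have h3 := Subgroup.mem_subgroupOf.1 (QuotientGroup.eq.1 h2)
    have h4 : (h : G) = k := by simpa using congrArg Subtype.val h1
    rw [h4]
    simpa using h3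

/-- Admissible maps are stable under pullback. -/
theorem Admissible.of_isCartesian {O : IndexingSystem G} {P X Y Z : FinGSet.{u} G} {p : P.Hom X}
    {q : P.Hom Z} {f : X.Hom Y} {g : Z.Hom Y} (hc : FinGSet.IsCartesian p q f g)
    (hf : O.Admissible f) : O.Admissible q := by
  intro w
  have hle : ∀ k ∈ MulAction.stabilizer G (q w),
      (1 : G)⁻¹ * k * 1 ∈ MulAction.stabilizer G (f (p w)) := by
    intro k hk
    rw [inv_one, one_mul, mul_one, MulAction.mem_stabilizer_iff, hc.comm, ← map_smul,
      MulAction.mem_stabilizer_iff.1 hk]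
  refine O.mem_orbit_of_mem _ _ _ (O.mem_restrict _ _ 1 hle _ (hf (p w)))
    (QuotientGroup.mk 1) fun h => ?_
  change _ ↔ QuotientGroup.mk ((⟨(1 : G)⁻¹ * h * 1, hle h h.2⟩ :
    MulAction.stabilizer G (f (p w))) * 1) = QuotientGroup.mk 1
  rw [eq_comm, QuotientGroup.eq, Subgroup.mem_subgroupOf]
  simp only [inv_one, mul_one, one_mul, MulAction.mem_stabilizer_iff]
  refine ⟨fun hw => by rw [← map_smul, hw], fun hw => ?_⟩
  refine (hc.existsUnique (p w) (q w) (hc.comm w)).unique ⟨?_, ?_⟩ ⟨rfl, rfl⟩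
  · rw [map_smul, hw]
  · rw [map_smul]; exact MulAction.mem_stabilizer_iff.1 h.2

/-- The projection `X ×_Y X - Δ(X) → X` is admissible when `f : X → Y` is. -/
theorem Admissible.offDiagFst {O : IndexingSystem G} {X Y : FinGSet.{u} G} {f : X.Hom Y}
    (hf : O.Admissible f) : O.Admissible (FinGSet.offDiagFst f) := by
  intro w
  have hle : ∀ k ∈ MulAction.stabilizer G w.1.1,
      (1 : G)⁻¹ * k * 1 ∈ MulAction.stabilizer G (f w.1.2) := by
    intro k hk
    rw [inv_one, one_mul, mul_one, MulAction.mem_stabilizer_iff, ← w.2.1, ← map_smul,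
      MulAction.mem_stabilizer_iff.1 hk]
  refine O.mem_orbit_of_mem _ _ _ (O.mem_restrict _ _ 1 hle _ (hf w.1.2))
    (QuotientGroup.mk 1) fun h => ?_
  change _ ↔ QuotientGroup.mk ((⟨(1 : G)⁻¹ * h * 1, hle h h.2⟩ :
    MulAction.stabilizer G (f w.1.2)) * 1) = QuotientGroup.mk 1
  rw [eq_comm, QuotientGroup.eq, Subgroup.mem_subgroupOf]
  simp only [inv_one, mul_one, one_mul, MulAction.mem_stabilizer_iff]
  refine ⟨fun hw => congrArg (fun z => z.1.2) hw, fun hw => ?_⟩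
  exact Subtype.ext (Prod.ext (MulAction.mem_stabilizer_iff.1 h.2) hw)

/-- The map `g' : X ×_Y ∏_g A → ∏_g A` is admissible when `g : X → Y` is. -/
theorem Admissible.depProdSnd {O : IndexingSystem G} {A X Y : FinGSet.{u} G} (h : A.Hom X)
    {g : X.Hom Y} (hg : O.Admissible g) : O.Admissible (FinGSet.depProdSnd h g) :=
  hg.of_isCartesian (FinGSet.isCartesian_depProd h g)

end IndexingSystem

/-! ### Mackey functors and Tambara functors -/

/-- A Mackey functor: abelian groups `M(X)` for finite `G`-sets `X`, with restrictions and
transfers satisfying the double coset formula, and taking disjoint unions to products. -/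
structure MackeyFunctor (G : Type u) [Group G] : Type (max (u + 1) (v + 1)) where
  obj : FinGSet.{u} G → Type v
  [addCommGroup : ∀ X, AddCommGroup (obj X)]
  res : ∀ {X Y : FinGSet.{u} G}, X.Hom Y → (obj Y →+ obj X)
  tr : ∀ {X Y : FinGSet.{u} G}, X.Hom Y → (obj X →+ obj Y)
  res_id : ∀ (X : FinGSet.{u} G) (a : obj X), res (X := X) (Y := X) (MulActionHom.id G) a = a
  res_comp : ∀ {X Y Z : FinGSet.{u} G} (f : X.Hom Y) (g : Y.Hom Z) (a : obj Z),
    res (X := X) (Y := Z) (MulActionHom.comp g f) a = res f (res g a)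
  tr_id : ∀ (X : FinGSet.{u} G) (a : obj X), tr (X := X) (Y := X) (MulActionHom.id G) a = a
  tr_comp : ∀ {X Y Z : FinGSet.{u} G} (f : X.Hom Y) (g : Y.Hom Z) (a : obj X),
    tr (X := X) (Y := Z) (MulActionHom.comp g f) a = tr g (tr f a)
  res_tr : ∀ {P X Y Z : FinGSet.{u} G} (p : P.Hom X) (q : P.Hom Z) (f : X.Hom Y) (g : Z.Hom Y),
    FinGSet.IsCartesian p q f g → ∀ a : obj X, res g (tr f a) = tr q (res p a)
  subsingleton_of_isEmpty : ∀ X : FinGSet.{u} G, IsEmpty X → Subsingleton (obj X)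
  bijective_sum : ∀ X Y : FinGSet.{u} G, Function.Bijective
    (fun a : obj (X.sum Y) => (res (FinGSet.inl X Y) a, res (FinGSet.inr X Y) a))

attribute [instance] MackeyFunctor.addCommGroup

/-- An `O`-Tambara functor: commutative rings `S(X)` for finite `G`-sets `X`, with restrictions
`R_f`, transfers `T_f` and, for `O`-admissible `f`, norms `N_f`, satisfying the double coset
formulas, Frobenius reciprocity and the Tambara relation `N_g T_h = T_{h'} N_{g'} R_{f'}` for
exponential diagrams, and taking disjoint unions to products. -/
structure TambaraFunctor {G : Type u} [Group G] [Finite G] (O : IndexingSystem.{u} G) :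
    Type (max (u + 1) (v + 1)) where
  obj : FinGSet.{u} G → Type v
  [commRing : ∀ X, CommRing (obj X)]
  res : ∀ {X Y : FinGSet.{u} G}, X.Hom Y → (obj Y →+* obj X)
  tr : ∀ {X Y : FinGSet.{u} G}, X.Hom Y → (obj X →+ obj Y)
  nm : ∀ {X Y : FinGSet.{u} G} (f : X.Hom Y), O.Admissible f → (obj X →* obj Y)
  res_id : ∀ (X : FinGSet.{u} G) (a : obj X), res (X := X) (Y := X) (MulActionHom.id G) a = a
  res_comp : ∀ {X Y Z : FinGSet.{u} G} (f : X.Hom Y) (g : Y.Hom Z) (a : obj Z),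
    res (X := X) (Y := Z) (MulActionHom.comp g f) a = res f (res g a)
  tr_id : ∀ (X : FinGSet.{u} G) (a : obj X), tr (X := X) (Y := X) (MulActionHom.id G) a = a
  tr_comp : ∀ {X Y Z : FinGSet.{u} G} (f : X.Hom Y) (g : Y.Hom Z) (a : obj X),
    tr (X := X) (Y := Z) (MulActionHom.comp g f) a = tr g (tr f a)
  nm_id : ∀ (X : FinGSet.{u} G) (a : obj X), nm _ (O.admissible_id X) a = a
  nm_comp : ∀ {X Y Z : FinGSet.{u} G} (f : X.Hom Y) (g : Y.Hom Z) (hf : O.Admissible f)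
    (hg : O.Admissible g) (a : obj X), nm (X := X) (Y := Z) (MulActionHom.comp g f) (hg.comp hf) a
      = nm g hg (nm f hf a)
  res_tr : ∀ {P X Y Z : FinGSet.{u} G} (p : P.Hom X) (q : P.Hom Z) (f : X.Hom Y) (g : Z.Hom Y),
    FinGSet.IsCartesian p q f g → ∀ a : obj X, res g (tr f a) = tr q (res p a)
  res_nm : ∀ {P X Y Z : FinGSet.{u} G} (p : P.Hom X) (q : P.Hom Z) (f : X.Hom Y) (g : Z.Hom Y)
    (hc : FinGSet.IsCartesian p q f g) (hf : O.Admissible f) (a : obj X),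
    res g (nm f hf a) = nm q (hf.of_isCartesian hc) (res p a)
  tr_mul : ∀ {X Y : FinGSet.{u} G} (f : X.Hom Y) (a : obj X) (b : obj Y),
    tr f a * b = tr f (a * res f b)
  nm_tr : ∀ {A X Y : FinGSet.{u} G} (h : A.Hom X) (g : X.Hom Y) (hg : O.Admissible g) (a : obj A),
    nm g hg (tr h a) = tr (FinGSet.depProdBase h g)
      (nm (FinGSet.depProdSnd h g) (hg.depProdSnd h) (res (FinGSet.depProdEval h g) a))
  subsingleton_of_isEmpty : ∀ X : FinGSet.{u} G, IsEmpty X → Subsingleton (obj X)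
  bijective_sum : ∀ X Y : FinGSet.{u} G, Function.Bijective
    (fun a : obj (X.sum Y) => (res (FinGSet.inl X Y) a, res (FinGSet.inr X Y) a))

attribute [instance] TambaraFunctor.commRing

namespace TambaraFunctor

variable {G : Type u} [Group G] [Finite G] {O : IndexingSystem.{u} G}

/-- A map of `O`-Tambara functors: ring homomorphisms commuting with restrictions, transfers and
norms. -/
@[ext]
structure Hom (R S : TambaraFunctor.{u, v} O) : Type (max (u + 1) v) where
  app : ∀ X : FinGSet.{u} G, R.obj X →+* S.obj X
  app_res : ∀ {X Y : FinGSet.{u} G} (f : X.Hom Y) (a : R.obj Y),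
    app X (R.res f a) = S.res f (app Y a)
  app_tr : ∀ {X Y : FinGSet.{u} G} (f : X.Hom Y) (a : R.obj X),
    app Y (R.tr f a) = S.tr f (app X a)
  app_nm : ∀ {X Y : FinGSet.{u} G} (f : X.Hom Y) (hf : O.Admissible f) (a : R.obj X),
    app Y (R.nm f hf a) = S.nm f hf (app X a)

instance : Category.{max (u + 1) v} (TambaraFunctor.{u, v} O) where
  Hom R S := Hom R S
  id R := ⟨fun X => RingHom.id _, fun _ _ => rfl, fun _ _ => rfl, fun _ _ _ => rfl⟩
  comp α β :=
    { app := fun X => (β.app X).comp (α.app X)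
      app_res := fun f a => by simp only [RingHom.comp_apply, α.app_res, β.app_res]
      app_tr := fun f a => by simp only [RingHom.comp_apply, α.app_tr, β.app_tr]
      app_nm := fun f hf a => by simp only [RingHom.comp_apply, α.app_nm, β.app_nm] }

/-- The component at `X` of a map of `O`-Tambara functors. -/
abbrev app {R S : TambaraFunctor.{u, v} O} (α : R ⟶ S) (X : FinGSet.{u} G) :
    R.obj X →+* S.obj X :=
  Hom.app α X

theorem hom_ext {R S : TambaraFunctor.{u, v} O} {α β : R ⟶ S}
    (h : ∀ (X : FinGSet.{u} G) (a : R.obj X), app α X a = app β X a) : α = β :=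
  Hom.ext (funext fun X => RingHom.ext (h X))

/-! ### Fibre products of Tambara functors -/

section FiberProd

variable {R S B : TambaraFunctor.{u, v} O} (α : R ⟶ B) (β : S ⟶ B)

/-- The ring `R(X) ×_{B(X)} S(X)`. -/
abbrev fiberProdSubring (X : FinGSet.{u} G) : Subring (R.obj X × S.obj X) :=
  RingHom.eqLocus ((app α X).comp (RingHom.fst _ _)) ((app β X).comp (RingHom.snd _ _))

/-- The fibre product `R ×_B S`, formed levelwise. -/
def fiberProd : TambaraFunctor.{u, v} O where
  obj X := fiberProdSubring α β X
  res {X Y} f := (((R.res f).prodMap (S.res f)).comp (fiberProdSubring α β Y).subtype).codRestrict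
    (fiberProdSubring α β X) (fun a => by
      have h : app α Y a.1.1 = app β Y a.1.2 := a.2
      change app α X (R.res f a.1.1) = app β X (S.res f a.1.2)
      rw [Hom.app_res, Hom.app_res, h])
  tr {X Y} f :=
    { toFun := fun a => ⟨(R.tr f a.1.1, S.tr f a.1.2), by
        have h : app α X a.1.1 = app β X a.1.2 := a.2
        change app α Y (R.tr f a.1.1) = app β Y (S.tr f a.1.2)
        rw [Hom.app_tr, Hom.app_tr, h]⟩
      map_zero' := Subtype.ext (Prod.ext (map_zero _) (map_zero _))
      map_add' := fun a b => Subtype.ext (Prod.ext (map_add _ _ _) (map_add _ _ _)) }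
  nm {X Y} f hf :=
    { toFun := fun a => ⟨(R.nm f hf a.1.1, S.nm f hf a.1.2), by
        have h : app α X a.1.1 = app β X a.1.2 := a.2
        change app α Y (R.nm f hf a.1.1) = app β Y (S.nm f hf a.1.2)
        rw [Hom.app_nm, Hom.app_nm, h]⟩
      map_one' := Subtype.ext (Prod.ext (map_one _) (map_one _))
      map_mul' := fun a b => Subtype.ext (Prod.ext (map_mul _ _ _) (map_mul _ _ _)) }
  res_id X a := Subtype.ext (Prod.ext (R.res_id X _) (S.res_id X _))
  res_comp f g a := Subtype.ext (Prod.ext (R.res_comp f g _) (S.res_comp f g _))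
  tr_id X a := Subtype.ext (Prod.ext (R.tr_id X _) (S.tr_id X _))
  tr_comp f g a := Subtype.ext (Prod.ext (R.tr_comp f g _) (S.tr_comp f g _))
  nm_id X a := Subtype.ext (Prod.ext (R.nm_id X _) (S.nm_id X _))
  nm_comp f g hf hg a := Subtype.ext (Prod.ext (R.nm_comp f g hf hg _) (S.nm_comp f g hf hg _))
  res_tr p q f g hc a := Subtype.ext (Prod.ext (R.res_tr p q f g hc _) (S.res_tr p q f g hc _))
  res_nm p q f g hc hf a :=
    Subtype.ext (Prod.ext (R.res_nm p q f g hc hf _) (S.res_nm p q f g hc hf _))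
  tr_mul f a b := Subtype.ext (Prod.ext (R.tr_mul f _ _) (S.tr_mul f _ _))
  nm_tr h g hg a := Subtype.ext (Prod.ext (R.nm_tr h g hg _) (S.nm_tr h g hg _))
  subsingleton_of_isEmpty X hX := by
    have := R.subsingleton_of_isEmpty X hX
    have := S.subsingleton_of_isEmpty X hX
    infer_instance
  bijective_sum X Y := by
    constructor
    · intro a b hab
      refine Subtype.ext (Prod.ext ?_ ?_)
      · exact (R.bijective_sum X Y).1
          (Prod.ext (congrArg (fun z => z.1.1.1) hab) (congrArg (fun z => z.2.1.1) hab))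
      · exact (S.bijective_sum X Y).1
          (Prod.ext (congrArg (fun z => z.1.1.2) hab) (congrArg (fun z => z.2.1.2) hab))
    · rintro ⟨a, b⟩
      obtain ⟨r, hr⟩ := (R.bijective_sum X Y).2 (a.1.1, b.1.1)
      obtain ⟨s, hs⟩ := (S.bijective_sum X Y).2 (a.1.2, b.1.2)
      have hr1 := congrArg Prod.fst hr
      have hr2 := congrArg Prod.snd hr
      have hs1 := congrArg Prod.fst hs
      have hs2 := congrArg Prod.snd hs
      dsimp only at hr1 hr2 hs1 hs2
      have ha : app α X a.1.1 = app β X a.1.2 := a.2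
      have hb : app α Y b.1.1 = app β Y b.1.2 := b.2
      have hrs : app α (X.sum Y) r = app β (X.sum Y) s := by
        refine (B.bijective_sum X Y).1 (Prod.ext ?_ ?_)
        · dsimp only
          rw [← Hom.app_res, ← Hom.app_res, hr1, hs1, ha]
        · dsimp only
          rw [← Hom.app_res, ← Hom.app_res, hr2, hs2, hb]
      exact ⟨⟨(r, s), hrs⟩, Prod.ext (Subtype.ext (Prod.ext hr1 hs1))
        (Subtype.ext (Prod.ext hr2 hs2))⟩

/-- The first projection `R ×_B S → R`. -/
def fiberProdFst : fiberProd α β ⟶ R where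
  app X := (RingHom.fst _ _).comp (fiberProdSubring α β X).subtype
  app_res _ _ := rfl
  app_tr _ _ := rfl
  app_nm _ _ _ := rfl

/-- The second projection `R ×_B S → S`. -/
def fiberProdSnd : fiberProd α β ⟶ S where
  app X := (RingHom.snd _ _).comp (fiberProdSubring α β X).subtype
  app_res _ _ := rfl
  app_tr _ _ := rfl
  app_nm _ _ _ := rfl

variable {α β} in
/-- The map to `R ×_B S` with given components. -/
def fiberProdLift {T : TambaraFunctor.{u, v} O} (γ : T ⟶ R) (δ : T ⟶ S) (h : γ ≫ α = δ ≫ β) :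
    T ⟶ fiberProd α β where
  app X := ((app γ X).prod (app δ X)).codRestrict (fiberProdSubring α β X)
    (fun t => congrArg (fun z => app z X t) h)
  app_res f a := Subtype.ext (Prod.ext (Hom.app_res γ f a) (Hom.app_res δ f a))
  app_tr f a := Subtype.ext (Prod.ext (Hom.app_tr γ f a) (Hom.app_tr δ f a))
  app_nm f hf a := Subtype.ext (Prod.ext (Hom.app_nm γ f hf a) (Hom.app_nm δ f hf a))

theorem fiberProd_condition : fiberProdFst α β ≫ α = fiberProdSnd α β ≫ β :=
  hom_ext fun _ a => a.2

end FiberProd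

end TambaraFunctor

/-! ### Augmented algebras -/

section AugmentedAlgebras

open CategoryTheory.Limits MonoidalCategory CartesianMonoidalCategory MonObj

variable {G : Type u} [Group G] [Finite G] {O : IndexingSystem.{u} G}

/-- The category `A-CAlg/B` of `A`-algebras over the `A`-algebra `B`, for `φ : A → B`. -/
abbrev AugCAlg {A B : TambaraFunctor.{u, v} O} (φ : A ⟶ B) :=
  Over (Under.mk φ)

namespace AugCAlg

variable {A B : TambaraFunctor.{u, v} O} {φ : A ⟶ B}

/-- The underlying `O`-Tambara functor `R` of an object `A → R → B` of `A-CAlg/B`. -/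
abbrev toTambara (R : AugCAlg φ) : TambaraFunctor.{u, v} O := R.left.right

/-- The structure map `A → R`. -/
abbrev alg (R : AugCAlg φ) : A ⟶ R.toTambara := R.left.hom

/-- The augmentation `R → B`. -/
abbrev aug (R : AugCAlg φ) : R.toTambara ⟶ B := R.hom.right

theorem alg_aug (R : AugCAlg φ) : R.alg ≫ R.aug = φ := Under.w R.hom

/-- The map of `O`-Tambara functors underlying a morphism of `A-CAlg/B`. -/
abbrev homTambara {R S : AugCAlg φ} (f : R ⟶ S) : R.toTambara ⟶ S.toTambara := f.left.right

theorem alg_hom {R S : AugCAlg φ} (f : R ⟶ S) : R.alg ≫ homTambara f = S.alg := Under.w f.left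

theorem hom_aug {R S : AugCAlg φ} (f : R ⟶ S) : homTambara f ≫ S.aug = R.aug :=
  congrArg CommaMorphism.right (Over.w f)

theorem hom_ext {R S : AugCAlg φ} {f g : R ⟶ S} (h : homTambara f = homTambara g) : f = g :=
  Over.OverMorphism.ext (Under.UnderMorphism.ext h)

/-- The object of `A-CAlg/B` given by `A → R → B`. -/
abbrev mk (R : TambaraFunctor.{u, v} O) (a : A ⟶ R) (ε : R ⟶ B) (h : a ≫ ε = φ) : AugCAlg φ :=
  Over.mk (Y := Under.mk a) (Under.homMk ε h)

/-- Constructor for morphisms of `A-CAlg/B`. -/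
abbrev homMk {R S : AugCAlg φ} (f : R.toTambara ⟶ S.toTambara) (h₁ : R.alg ≫ f = S.alg)
    (h₂ : f ≫ S.aug = R.aug) : R ⟶ S :=
  Over.homMk (Under.homMk f h₁) (Under.UnderMorphism.ext h₂)

/-- The product of `R` and `S` in `A-CAlg/B` is the fibre product `R ×_B S`. -/
def prod (R S : AugCAlg φ) : AugCAlg φ :=
  mk (TambaraFunctor.fiberProd R.aug S.aug)
    (TambaraFunctor.fiberProdLift R.alg S.alg (by rw [alg_aug, alg_aug]))
    (TambaraFunctor.fiberProdFst R.aug S.aug ≫ R.aug) R.alg_aug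

/-- The binary product cone. -/
def binaryFan (R S : AugCAlg φ) : BinaryFan R S :=
  BinaryFan.mk (P := prod R S)
    (homMk (TambaraFunctor.fiberProdFst R.aug S.aug) rfl rfl)
    (homMk (TambaraFunctor.fiberProdSnd R.aug S.aug) rfl
      (TambaraFunctor.fiberProd_condition _ _).symm)

/-- The fibre product is the product in `A-CAlg/B`. -/
def binaryFanIsLimit (R S : AugCAlg φ) : IsLimit (binaryFan R S) :=
  BinaryFan.IsLimit.mk _
    (fun {T} f g => homMk (S := prod R S)
      (TambaraFunctor.fiberProdLift (homTambara f) (homTambara g) (by rw [hom_aug, hom_aug]))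
      (TambaraFunctor.hom_ext fun X a => Subtype.ext (Prod.ext
        (congrArg (fun z => TambaraFunctor.app z X a) (alg_hom f))
        (congrArg (fun z => TambaraFunctor.app z X a) (alg_hom g))))
      (hom_aug f))
    (fun _ _ => rfl) (fun _ _ => rfl)
    (fun f g m h₁ h₂ => hom_ext (TambaraFunctor.hom_ext fun X a => Subtype.ext (Prod.ext
      (congrArg (fun z => TambaraFunctor.app (homTambara z) X a) h₁)
      (congrArg (fun z => TambaraFunctor.app (homTambara z) X a) h₂))))

/-- The cartesian monoidal structure of `A-CAlg/B`: the terminal object is `B` and products are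
fibre products over `B`. -/
noncomputable instance : CartesianMonoidalCategory (AugCAlg φ) :=
  .ofChosenFiniteProducts
    ⟨asEmptyCone (Over.mk (𝟙 (Under.mk φ))), Over.mkIdTerminal⟩
    fun R S => ⟨binaryFan R S, binaryFanIsLimit R S⟩

noncomputable instance : BraidedCategory (AugCAlg φ) := .ofCartesianMonoidalCategory

/-- The unit `B → R` of an abelian group object `R` of `A-CAlg/B`. -/
noncomputable def unit (R : CommGrp (AugCAlg φ)) : B ⟶ R.X.toTambara := homTambara η[R.X]

end AugCAlg

end AugmentedAlgebras

/-! ### Modules over Tambara functors -/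

/-- A module over an `O`-Tambara functor `B`: a Mackey functor `M` with a `B(X)`-module structure
on each `M(X)` such that restrictions are semilinear and both Frobenius relations hold. -/
structure TambaraModule {G : Type u} [Group G] [Finite G] {O : IndexingSystem.{u} G}
    (B : TambaraFunctor.{u, v} O) extends MackeyFunctor.{u, v} G where
  [module : ∀ X, Module (B.obj X) (obj X)]
  res_smul : ∀ {X Y : FinGSet.{u} G} (f : X.Hom Y) (s : B.obj Y) (m : obj Y),
    res f (s • m) = B.res f s • res f m
  smul_tr : ∀ {X Y : FinGSet.{u} G} (f : X.Hom Y) (s : B.obj Y) (m : obj X),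
    s • tr f m = tr f (B.res f s • m)
  tr_smul : ∀ {X Y : FinGSet.{u} G} (f : X.Hom Y) (s : B.obj X) (m : obj Y),
    B.tr f s • m = tr f (s • res f m)

attribute [instance] TambaraModule.module

namespace TambaraModule

variable {G : Type u} [Group G] [Finite G] {O : IndexingSystem.{u} G}
  {B : TambaraFunctor.{u, v} O}

/-- A map of `B`-modules. -/
@[ext]
structure Hom (M N : TambaraModule.{u, v} B) : Type (max (u + 1) v) where
  app : ∀ X : FinGSet.{u} G, M.obj X →ₗ[B.obj X] N.obj X
  app_res : ∀ {X Y : FinGSet.{u} G} (f : X.Hom Y) (m : M.obj Y),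
    app X (M.res f m) = N.res f (app Y m)
  app_tr : ∀ {X Y : FinGSet.{u} G} (f : X.Hom Y) (m : M.obj X),
    app Y (M.tr f m) = N.tr f (app X m)

instance : Category.{max (u + 1) v} (TambaraModule.{u, v} B) where
  Hom M N := Hom M N
  id M := ⟨fun X => LinearMap.id, fun _ _ => rfl, fun _ _ => rfl⟩
  comp α β :=
    { app := fun X => (β.app X).comp (α.app X)
      app_res := fun f a => by simp only [LinearMap.comp_apply, α.app_res, β.app_res]
      app_tr := fun f a => by simp only [LinearMap.comp_apply, α.app_tr, β.app_tr] }

/-- The component at `X` of a map of `B`-modules. -/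
abbrev app {M N : TambaraModule.{u, v} B} (α : M ⟶ N) (X : FinGSet.{u} G) :
    M.obj X →ₗ[B.obj X] N.obj X :=
  Hom.app α X

theorem hom_ext {M N : TambaraModule.{u, v} B} {α β : M ⟶ N}
    (h : ∀ (X : FinGSet.{u} G) (a : M.obj X), app α X a = app β X a) : α = β :=
  Hom.ext (funext fun X => LinearMap.ext (h X))

end TambaraModule

/-! ### The augmentation ideal -/

section AugmentationIdeal

open MonoidalCategory CartesianMonoidalCategory MonObj

variable {G : Type u} [Group G] [Finite G] {O : IndexingSystem.{u} G}
  {A B : TambaraFunctor.{u, v} O} {φ : A ⟶ B}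

/-- The kernel of `R(X) → B(X)`. -/
abbrev AugCAlg.ker (R : AugCAlg φ) (X : FinGSet.{u} G) : Ideal (R.toTambara.obj X) :=
  RingHom.ker (TambaraFunctor.app R.aug X)

/-- The augmentation ideal of an abelian group object `R` of `A-CAlg/B`: the kernel of `R → B`,
on which `B` acts through the unit `B → R` and the multiplication of `R`. -/
noncomputable def augIdealObj (R : CommGrp (AugCAlg φ)) : TambaraModule.{u, v} B where
  obj X := R.X.ker X
  res {X Y} f :=
    { toFun := fun a => ⟨R.X.toTambara.res f a.1, by
        rw [RingHom.mem_ker, TambaraFunctor.Hom.app_res, RingHom.mem_ker.1 a.2, map_zero]⟩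
      map_zero' := Subtype.ext (map_zero _)
      map_add' := fun a b => Subtype.ext (map_add _ _ _) }
  tr {X Y} f :=
    { toFun := fun a => ⟨R.X.toTambara.tr f a.1, by
        rw [RingHom.mem_ker, TambaraFunctor.Hom.app_tr, RingHom.mem_ker.1 a.2, map_zero]⟩
      map_zero' := Subtype.ext (map_zero _)
      map_add' := fun a b => Subtype.ext (map_add _ _ _) }
  module X := Module.compHom (R.X.ker X) (TambaraFunctor.app (AugCAlg.unit R) X)
  res_id X a := Subtype.ext (R.X.toTambara.res_id X _)
  res_comp f g a := Subtype.ext (R.X.toTambara.res_comp f g _)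
  tr_id X a := Subtype.ext (R.X.toTambara.tr_id X _)
  tr_comp f g a := Subtype.ext (R.X.toTambara.tr_comp f g _)
  res_tr p q f g hc a := Subtype.ext (R.X.toTambara.res_tr p q f g hc _)
  subsingleton_of_isEmpty X hX := by
    have := R.X.toTambara.subsingleton_of_isEmpty X hX
    infer_instance
  bijective_sum X Y := by
    constructor
    · intro a b hab
      exact Subtype.ext ((R.X.toTambara.bijective_sum X Y).1
        (Prod.ext (congrArg (fun z => z.1.1) hab) (congrArg (fun z => z.2.1) hab)))
    · rintro ⟨a, b⟩
      obtain ⟨r, hr⟩ := (R.X.toTambara.bijective_sum X Y).2 (a.1, b.1)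
      have h1 := congrArg Prod.fst hr
      have h2 := congrArg Prod.snd hr
      dsimp only at h1 h2
      have hk : r ∈ R.X.ker (X.sum Y) := by
        refine RingHom.mem_ker.2 ((B.bijective_sum X Y).1 (Prod.ext ?_ ?_))
        · dsimp only
          rw [← TambaraFunctor.Hom.app_res, h1, RingHom.mem_ker.1 a.2, map_zero]
        · dsimp only
          rw [← TambaraFunctor.Hom.app_res, h2, RingHom.mem_ker.1 b.2, map_zero]
      exact ⟨⟨r, hk⟩, Prod.ext (Subtype.ext h1) (Subtype.ext h2)⟩
  res_smul {X Y} f s m := Subtype.ext (by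
    change R.X.toTambara.res f (TambaraFunctor.app (AugCAlg.unit R) Y s * m.1)
      = TambaraFunctor.app (AugCAlg.unit R) X (B.res f s) * R.X.toTambara.res f m.1
    rw [map_mul, TambaraFunctor.Hom.app_res])
  smul_tr {X Y} f s m := Subtype.ext (by
    change TambaraFunctor.app (AugCAlg.unit R) Y s * R.X.toTambara.tr f m.1
      = R.X.toTambara.tr f (TambaraFunctor.app (AugCAlg.unit R) X (B.res f s) * m.1)
    rw [TambaraFunctor.Hom.app_res, mul_comm, R.X.toTambara.tr_mul, mul_comm])
  tr_smul {X Y} f s m := Subtype.ext (by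
    change TambaraFunctor.app (AugCAlg.unit R) Y (B.tr f s) * m.1
      = R.X.toTambara.tr f (TambaraFunctor.app (AugCAlg.unit R) X s * R.X.toTambara.res f m.1)
    rw [TambaraFunctor.Hom.app_tr, R.X.toTambara.tr_mul])

theorem AugCAlg.unit_hom {R S : CommGrp (AugCAlg φ)} (f : R ⟶ S) :
    AugCAlg.unit R ≫ AugCAlg.homTambara f.hom.hom.hom = AugCAlg.unit S :=
  congrArg AugCAlg.homTambara (IsMonHom.one_hom f.hom.hom.hom)

variable (φ) in
/-- The augmentation ideal functor from abelian group objects of `A-CAlg/B` to `B`-modules. -/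
noncomputable def augIdeal : CommGrp (AugCAlg φ) ⥤ TambaraModule.{u, v} B where
  obj := augIdealObj
  map {R S} f :=
    { app := fun X =>
        { toFun := fun a => ⟨TambaraFunctor.app (AugCAlg.homTambara f.hom.hom.hom) X a.1, by
            refine RingHom.mem_ker.2 (Eq.trans ?_ (RingHom.mem_ker.1 a.2))
            exact congrArg (fun z => TambaraFunctor.app z X a.1)
              (AugCAlg.hom_aug f.hom.hom.hom)⟩
          map_add' := fun a b => Subtype.ext (map_add _ _ _)
          map_smul' := fun s a => Subtype.ext (by
            refine (map_mul (TambaraFunctor.app (AugCAlg.homTambara f.hom.hom.hom) X)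
              (TambaraFunctor.app (AugCAlg.unit R) X s) a.1).trans ?_
            exact congrArg (· * TambaraFunctor.app (AugCAlg.homTambara f.hom.hom.hom) X a.1)
              (congrArg (fun z => TambaraFunctor.app z X s) (AugCAlg.unit_hom f))) }
      app_res := fun g a => Subtype.ext (TambaraFunctor.Hom.app_res _ g a.1)
      app_tr := fun g a => Subtype.ext (TambaraFunctor.Hom.app_tr _ g a.1) }
  map_id _ := rfl
  map_comp _ _ := rfl

variable (φ) in
/-- The abelian group objects `R` of `A-CAlg/B` such that `N_f` vanishes on the augmentation ideal
for all 2-surjective admissible `f`. -/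
def normsVanish : ObjectProperty (CommGrp (AugCAlg φ)) := fun R =>
  ∀ {X Y : FinGSet.{u} G} (f : X.Hom Y) (hf : O.Admissible f), FinGSet.TwoSurjective f →
    ∀ r ∈ R.X.ker X, R.X.toTambara.nm f hf r = 0

/-! ### Square-zero extensions -/

/-- The norm of the square-zero extension `B ⋉ M`:
`N_f(b, m) = (N_f(b), T_f(N_{π₁} R_{π₂}(b) • m))` with `π₁, π₂ : X ×_Y X - Δ(X) → X` the
projections. -/
def sqZeroNorm (M : TambaraModule.{u, v} B) {X Y : FinGSet.{u} G} (f : X.Hom Y)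
    (hf : O.Admissible f) (x : B.obj X × M.obj X) : B.obj Y × M.obj Y :=
  (B.nm f hf x.1, M.tr f
    (B.nm (FinGSet.offDiagFst f) hf.offDiagFst (B.res (FinGSet.offDiagSnd f) x.1) • x.2))

/-- An identification of an abelian group object `R` of `A-CAlg/B` with the square-zero extension
`B ⋉ M`: bijections `R(X) ≅ B(X) × M(X)` under which every piece of structure of `R` is given by
the formula defining that structure on `B ⋉ M`. -/
structure SqZeroIso (M : TambaraModule.{u, v} B) (R : CommGrp (AugCAlg φ)) :
    Type (max (u + 1) v) where
  coord : ∀ X : FinGSet.{u} G, R.X.toTambara.obj X ≃ B.obj X × M.obj X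
  coord_add : ∀ (X : FinGSet.{u} G) (r s : R.X.toTambara.obj X),
    coord X (r + s) = ((coord X r).1 + (coord X s).1, (coord X r).2 + (coord X s).2)
  coord_one : ∀ X : FinGSet.{u} G, coord X 1 = (1, 0)
  coord_mul : ∀ (X : FinGSet.{u} G) (r s : R.X.toTambara.obj X), coord X (r * s) =
    ((coord X r).1 * (coord X s).1, (coord X r).1 • (coord X s).2 + (coord X s).1 • (coord X r).2)
  coord_res : ∀ {X Y : FinGSet.{u} G} (f : X.Hom Y) (r : R.X.toTambara.obj Y),
    coord X (R.X.toTambara.res f r) = (B.res f (coord Y r).1, M.res f (coord Y r).2)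
  coord_tr : ∀ {X Y : FinGSet.{u} G} (f : X.Hom Y) (r : R.X.toTambara.obj X),
    coord Y (R.X.toTambara.tr f r) = (B.tr f (coord X r).1, M.tr f (coord X r).2)
  coord_nm : ∀ {X Y : FinGSet.{u} G} (f : X.Hom Y) (hf : O.Admissible f)
    (r : R.X.toTambara.obj X), coord Y (R.X.toTambara.nm f hf r) = sqZeroNorm M f hf (coord X r)
  /-- The structure map `A → B ⋉ M` is `a ↦ (φ(a), 0)`. -/
  coord_alg : ∀ (X : FinGSet.{u} G) (a : A.obj X),
    coord X (TambaraFunctor.app R.X.alg X a) = (TambaraFunctor.app φ X a, 0)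
  /-- The augmentation `B ⋉ M → B` is `(b, m) ↦ b`. -/
  aug_eq : ∀ (X : FinGSet.{u} G) (r : R.X.toTambara.obj X),
    TambaraFunctor.app R.X.aug X r = (coord X r).1
  /-- The unit `B → B ⋉ M` of the group structure is `b ↦ (b, 0)`. -/
  coord_unit : ∀ (X : FinGSet.{u} G) (b : B.obj X),
    coord X (TambaraFunctor.app (AugCAlg.unit R) X b) = (b, 0)
  /-- The addition `(B ⋉ M) ×_B (B ⋉ M) → B ⋉ M` is `((b, m), (b, m')) ↦ (b, m + m')`. -/
  coord_groupAdd : ∀ (X : FinGSet.{u} G) (z : (R.X ⊗ R.X).toTambara.obj X),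
    coord X (TambaraFunctor.app (AugCAlg.homTambara μ[R.X]) X z) =
      ((coord X (TambaraFunctor.app (AugCAlg.homTambara (fst R.X R.X)) X z)).1,
        (coord X (TambaraFunctor.app (AugCAlg.homTambara (fst R.X R.X)) X z)).2 +
          (coord X (TambaraFunctor.app (AugCAlg.homTambara (snd R.X R.X)) X z)).2)
  /-- The inverse `B ⋉ M → B ⋉ M` is `(b, m) ↦ (b, -m)`. -/
  coord_groupInv : ∀ (X : FinGSet.{u} G) (r : R.X.toTambara.obj X),
    coord X (TambaraFunctor.app (AugCAlg.homTambara ι[R.X]) X r) =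
      ((coord X r).1, -(coord X r).2)

/-- An identification of a functor `S` from `B`-modules to abelian group objects of `A-CAlg/B` with
the square-zero extension functor `M ↦ B ⋉ M`, which sends `g` to `(b, m) ↦ (b, g(m))`. -/
structure SqZeroFunctorIso (S : TambaraModule.{u, v} B ⥤ CommGrp (AugCAlg φ)) :
    Type (max (u + 1) (v + 1)) where
  iso : ∀ M : TambaraModule.{u, v} B, SqZeroIso M (S.obj M)
  coord_map : ∀ {M N : TambaraModule.{u, v} B} (g : M ⟶ N) (X : FinGSet.{u} G)
    (r : (S.obj M).X.toTambara.obj X),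
    (iso N).coord X (TambaraFunctor.app (AugCAlg.homTambara (S.map g).hom.hom.hom) X r) =
      (((iso M).coord X r).1, TambaraModule.app g X ((iso M).coord X r).2)

end AugmentationIdeal

/-! The unit `η : B → R` of an abelian group object is a section of `ε : R → B`, so additively `R(X)
= η(B(X)) ⊕ I(X)`, where `I` is the augmentation ideal. What has to be understood is how products
and norms behave in this splitting.

Products. The group law `μ : R ×_B R → R` is levelwise a ring homomorphism with `μ(r, η(ε(r))) = r =
μ(η(ε(r)), r)`. An Eckmann–Hilton argument applies: additivity forces `μ(r, s) = r + s - η(ε(r))`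
(`AugCAlg.mul_apply`), and applying `μ` to `(r, 0) * (0, s) = 0` gives `I² = 0`
(`AugCAlg.mul_eq_zero_of_mem_ker`). So `R` is levelwise a square-zero extension, and its group law
is determined by `η`.

Norms. The sum `a + r` is the transfer of the pair `(a, r)` along the fold map `X ⊔ X → X`. The
Tambara relation rewrites `N_f(a + r)` as a transfer from `∏_f (X ⊔ X)`, the set of colourings of
fibres of `f` by two colours, which splits by the number of points of the second colour. No such
point gives `N_f(a)`. Exactly one gives `T_f(c_f(a) * r)`, where `c_f(a) = N_{π₁} R_{π₂}(a)`
(`cofactor`) is the product of `a` over the other points of the fibre. Two or more give a multiple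
of a norm of a restriction of `r` along a 2-surjective map, and this vanishes by hypothesis when `r
∈ I(X)`. This is `nm_add`; for `a = η(b)` it is the norm formula of `B ⋉ I`. Hence `(b, r) ↦ η(b) +
r` is an isomorphism `B ⋉ I ≅ R`.

Conversely, the norm formula defines a Tambara functor because `c_f` behaves like the derivative of
a product: `R_f N_f(b) = b * c_f(b)` (`res_nm_eq_mul_cofactor`), base change (`res_cofactor`), a
chain rule (`cofactor_comp`), and a compatibility with exponential diagrams (`res_cofactor_tr`). The
last one is the hardest: it compares two dependent products, by recording a section at a chosen
point and on the rest of the fibre separately. The vanishing condition holds for `B ⋉ M` because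
`N_f(0) = 0` and `c_f(0) = 0` for 2-surjective `f`, and the kernel of `B ⋉ M → B` is `M`. -/

namespace FinGSet

/-! ### Disjoint covers and basic pullback squares of finite `G`-sets -/

variable {G : Type u} [Group G]

/-- The empty `G`-set. -/
def empty (G : Type u) [Group G] : FinGSet.{u} G :=
  letI : MulAction G PEmpty.{u + 1} :=
    { smul := fun _ x => x
      one_smul := fun _ => rfl
      mul_smul := fun _ _ _ => rfl }
  ⟨PEmpty.{u + 1}⟩

instance : IsEmpty (empty G) := inferInstanceAs (IsEmpty PEmpty)

/-- The map from the empty `G`-set. -/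
def fromEmpty (X : FinGSet.{u} G) : (empty G).Hom X where
  toFun x := isEmptyElim x
  map_smul' _ x := isEmptyElim x

/-- The inverse of a bijective equivariant map. -/
noncomputable def Hom.inv {X Y : FinGSet.{u} G} (f : X.Hom Y) (hf : Function.Bijective f) :
    Y.Hom X where
  toFun := (Equiv.ofBijective f hf).symm
  map_smul' γ y := (Equiv.symm_apply_eq _).2 (by
    change γ • y = f (γ • (Equiv.ofBijective f hf).symm y)
    rw [map_smul, Equiv.ofBijective_apply_symm_apply f hf y])

theorem Hom.apply_inv {X Y : FinGSet.{u} G} (f : X.Hom Y) (hf : Function.Bijective f) (y : Y) :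
    f (Hom.inv f hf y) = y :=
  Equiv.ofBijective_apply_symm_apply f hf y

/-- The map `X ⊔ Y → Z` with given components. -/
def desc {X Y Z : FinGSet.{u} G} (f : X.Hom Z) (g : Y.Hom Z) : (X.sum Y).Hom Z where
  toFun := Sum.elim f g
  map_smul' := by
    rintro γ (x | y)
    · exact map_smul f γ x
    · exact map_smul g γ y

/-- The inclusion of a sub-`G`-set. -/
def subIncl (X : FinGSet.{u} G) (p : X → Prop) (hp : ∀ (g : G) (x : X), p x → p (g • x)) :
    (X.sub p hp).Hom X where
  toFun := Subtype.val
  map_smul' _ _ := rfl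

/-- The first projection of a fibre product. -/
def fiberProdFst {X Y Z : FinGSet.{u} G} (f : X.Hom Y) (g : Z.Hom Y) : (fiberProd f g).Hom X where
  toFun p := p.1.1
  map_smul' _ _ := rfl

/-- The second projection of a fibre product. -/
def fiberProdSnd {X Y Z : FinGSet.{u} G} (f : X.Hom Y) (g : Z.Hom Y) : (fiberProd f g).Hom Z where
  toFun p := p.1.2
  map_smul' _ _ := rfl

theorem isCartesian_fiberProd {X Y Z : FinGSet.{u} G} (f : X.Hom Y) (g : Z.Hom Y) :
    IsCartesian (fiberProdFst f g) (fiberProdSnd f g) f g where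
  comm := Subtype.property
  existsUnique x z hxz :=
    ⟨⟨(x, z), hxz⟩, ⟨rfl, rfl⟩, fun _ hw => Subtype.ext (Prod.ext hw.1 hw.2)⟩

/-- The maps `U → X` and `V → X` exhibit `X` as the disjoint union of `U` and `V`. -/
structure IsDisjointCover {U V X : FinGSet.{u} G} (i : U.Hom X) (j : V.Hom X) : Prop where
  injective_left : Function.Injective i
  injective_right : Function.Injective j
  ne : ∀ u v, i u ≠ j v
  cover : ∀ x, (∃ u, i u = x) ∨ ∃ v, j v = x

theorem IsDisjointCover.bijective_desc {U V X : FinGSet.{u} G} {i : U.Hom X} {j : V.Hom X}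
    (h : IsDisjointCover i j) : Function.Bijective (desc i j) := by
  constructor
  · rintro (a | a) (b | b) hab
    · exact congrArg Sum.inl (h.injective_left hab)
    · exact (h.ne _ _ hab).elim
    · exact (h.ne _ _ hab.symm).elim
    · exact congrArg Sum.inr (h.injective_right hab)
  · intro x
    obtain ⟨u, hu⟩ | ⟨v, hv⟩ := h.cover x
    · exact ⟨Sum.inl u, hu⟩
    · exact ⟨Sum.inr v, hv⟩

theorem IsDisjointCover.symm {U V X : FinGSet.{u} G} {i : U.Hom X} {j : V.Hom X}
    (h : IsDisjointCover i j) : IsDisjointCover j i :=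
  ⟨h.injective_right, h.injective_left, fun u v => (h.ne v u).symm, fun x => (h.cover x).symm⟩

theorem isDisjointCover_sum (X Y : FinGSet.{u} G) : IsDisjointCover (inl X Y) (inr X Y) where
  injective_left := Sum.inl_injective
  injective_right := Sum.inr_injective
  ne _ _ := Sum.inl_ne_inr
  cover
    | Sum.inl x => Or.inl ⟨x, rfl⟩
    | Sum.inr y => Or.inr ⟨y, rfl⟩

theorem isDisjointCover_of_bijective {X Y : FinGSet.{u} G} (f : X.Hom Y)
    (hf : Function.Bijective f) : IsDisjointCover f (fromEmpty Y) where
  injective_left := hf.1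
  injective_right := Function.injective_of_subsingleton _
  ne _ v := isEmptyElim v
  cover y := Or.inl (hf.2 y)

theorem isDisjointCover_sub (X : FinGSet.{u} G) (p : X → Prop)
    (hp : ∀ (g : G) (x : X), p x → p (g • x)) (hp' : ∀ (g : G) (x : X), ¬ p x → ¬ p (g • x)) :
    IsDisjointCover (X.subIncl p hp) (X.subIncl (fun x => ¬ p x) hp') where
  injective_left := Subtype.val_injective
  injective_right := Subtype.val_injective
  ne u v h := v.2 (by rw [← show u.1 = v.1 from h]; exact u.2)
  cover x := (em (p x)).imp (fun h => ⟨⟨x, h⟩, rfl⟩) fun h => ⟨⟨x, h⟩, rfl⟩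

/-- Through the double coset formulas this square gives `R_i T_i = id` and `R_i N_i = id`. -/
theorem isCartesian_of_injective {U X : FinGSet.{u} G} (i : U.Hom X) (hi : Function.Injective i) :
    IsCartesian (X := U) (Z := U) (MulActionHom.id G) (MulActionHom.id G) i i where
  comm _ := rfl
  existsUnique x _ h := ⟨x, ⟨rfl, hi h⟩, fun _ hw => hw.1⟩

/-- With the empty set as pullback, the double coset formulas give `R_j T_i = 0` and `R_j N_i = 1`.
-/
theorem isCartesian_of_disjoint {U V X : FinGSet.{u} G} (i : U.Hom X) (j : V.Hom X)
    (h : ∀ u v, i u ≠ j v) : IsCartesian (fromEmpty U) (fromEmpty V) i j where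
  comm w := isEmptyElim w
  existsUnique x z hxz := (h x z hxz).elim

end FinGSet

open FinGSet

/-! ### Admissibility of injections -/

namespace IndexingSystem

variable {G : Type u} [Group G] [Finite G] {O : IndexingSystem.{u} G}

/-- Injectivity makes the stabilizers of `s` and `f(s)` equal, so the orbit in question is a point,
hence a trivial set. -/
theorem admissible_of_injective {X Y : FinGSet.{u} G} (f : X.Hom Y) (hf : Function.Injective f) :
    O.Admissible f := by
  intro s
  refine O.mem_trivial _ _ ?_
  rintro h ⟨a⟩
  refine Quotient.sound (QuotientGroup.leftRel_apply.2 (Subgroup.mem_subgroupOf.2 ?_))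
  refine MulAction.mem_stabilizer_iff.2 (hf ?_)
  rw [map_smul]
  exact MulAction.mem_stabilizer_iff.1 (SetLike.coe_mem _)

theorem Admissible.congr {X Y : FinGSet.{u} G} {f g : X.Hom Y} (hf : O.Admissible f)
    (h : ∀ x, f x = g x) : O.Admissible g := by
  obtain rfl : f = g := MulActionHom.ext h
  exact hf

end IndexingSystem

/-! ### Restrictions, transfers and norms over disjoint covers -/

namespace MackeyFunctor

variable {G : Type u} [Group G] (M : MackeyFunctor.{u, v} G)

theorem tr_tr {X Y Z : FinGSet.{u} G} (f : X.Hom Y) (g : Y.Hom Z) (k : X.Hom Z)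
    (h : ∀ x, g (f x) = k x) (a : M.obj X) : M.tr g (M.tr f a) = M.tr k a := by
  obtain rfl : MulActionHom.comp g f = k := MulActionHom.ext h
  exact (M.tr_comp f g a).symm

end MackeyFunctor

namespace TambaraFunctor

variable {G : Type u} [Group G] [Finite G] {O : IndexingSystem.{u} G} (R : TambaraFunctor.{u, v} O)

/-- The composite is given as any `k` that agrees pointwise with it, so that different descriptions
of one map can be exchanged. The same form is used for transfers and norms below. -/
theorem res_res {X Y Z : FinGSet.{u} G} (f : X.Hom Y) (g : Y.Hom Z) (k : X.Hom Z)
    (h : ∀ x, g (f x) = k x) (a : R.obj Z) : R.res f (R.res g a) = R.res k a := by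
  obtain rfl : MulActionHom.comp g f = k := MulActionHom.ext h
  exact (R.res_comp f g a).symm

theorem res_res_comm {W X Y Z : FinGSet.{u} G} (f : X.Hom Y) (g : Y.Hom Z) (f' : X.Hom W)
    (g' : W.Hom Z) (h : ∀ x, g (f x) = g' (f' x)) (a : R.obj Z) :
    R.res f (R.res g a) = R.res f' (R.res g' a) :=
  (R.res_res f g (MulActionHom.comp g' f') h a).trans (R.res_comp f' g' a)

theorem res_eq_self {X : FinGSet.{u} G} (f : X.Hom X) (h : ∀ x, f x = x) (a : R.obj X) :
    R.res f a = a := by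
  obtain rfl : f = MulActionHom.id G := MulActionHom.ext h
  exact R.res_id X a

theorem res_congr {X Y : FinGSet.{u} G} {f g : X.Hom Y} (h : ∀ x, f x = g x) (a : R.obj Y) :
    R.res f a = R.res g a := by
  obtain rfl : f = g := MulActionHom.ext h
  rfl

theorem tr_tr {X Y Z : FinGSet.{u} G} (f : X.Hom Y) (g : Y.Hom Z) (k : X.Hom Z)
    (h : ∀ x, g (f x) = k x) (a : R.obj X) : R.tr g (R.tr f a) = R.tr k a := by
  obtain rfl : MulActionHom.comp g f = k := MulActionHom.ext h
  exact (R.tr_comp f g a).symm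

theorem nm_nm {X Y Z : FinGSet.{u} G} (f : X.Hom Y) (g : Y.Hom Z) (k : X.Hom Z)
    (h : ∀ x, g (f x) = k x) (hf : O.Admissible f) (hg : O.Admissible g) (hk : O.Admissible k)
    (a : R.obj X) : R.nm g hg (R.nm f hf a) = R.nm k hk a := by
  obtain rfl : MulActionHom.comp g f = k := MulActionHom.ext h
  exact (R.nm_comp f g hf hg a).symm

theorem tr_of_isEmpty {X Y : FinGSet.{u} G} [hX : IsEmpty X] (f : X.Hom Y) (a : R.obj X) :
    R.tr f a = 0 := by
  have := R.subsingleton_of_isEmpty X hX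
  rw [Subsingleton.elim a 0, map_zero]

theorem nm_of_isEmpty {X Y : FinGSet.{u} G} [hX : IsEmpty X] (f : X.Hom Y) (hf : O.Admissible f)
    (a : R.obj X) : R.nm f hf a = 1 := by
  have := R.subsingleton_of_isEmpty X hX
  rw [Subsingleton.elim a 1, map_one]

theorem res_injective_of_bijective {X Y : FinGSet.{u} G} (f : X.Hom Y)
    (hf : Function.Bijective f) : Function.Injective (R.res f) := by
  intro a b hab
  have := congrArg (R.res (Hom.inv f hf)) hab
  rwa [← R.res_comp, ← R.res_comp, R.res_eq_self _ (Hom.apply_inv f hf),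
    R.res_eq_self _ (Hom.apply_inv f hf)] at this

/-- This is the injectivity in the disjoint union axiom, transported along the bijection `U ⊔ V →
X`. -/
theorem ext_of_isDisjointCover {U V X : FinGSet.{u} G} {i : U.Hom X} {j : V.Hom X}
    (h : IsDisjointCover i j) {a b : R.obj X} (hi : R.res i a = R.res i b)
    (hj : R.res j a = R.res j b) : a = b := by
  refine R.res_injective_of_bijective _ h.bijective_desc ((R.bijective_sum U V).1 ?_)
  refine Prod.ext ?_ ?_
  · dsimp only
    rwa [R.res_res _ _ i fun _ => rfl, R.res_res _ _ i fun _ => rfl]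
  · dsimp only
    rwa [R.res_res _ _ j fun _ => rfl, R.res_res _ _ j fun _ => rfl]

theorem res_tr_self {U X : FinGSet.{u} G} (i : U.Hom X) (hi : Function.Injective i) (a : R.obj U) :
    R.res i (R.tr i a) = a := by
  rw [R.res_tr _ _ i i (isCartesian_of_injective i hi), R.res_id, R.tr_id]

theorem res_nm_self {U X : FinGSet.{u} G} (i : U.Hom X) (hi : Function.Injective i)
    (hi' : O.Admissible i) (a : R.obj U) : R.res i (R.nm i hi' a) = a := by
  rw [R.res_nm _ _ i i (isCartesian_of_injective i hi), R.res_id, R.nm_id]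

theorem res_tr_of_disjoint {U V X : FinGSet.{u} G} {i : U.Hom X} {j : V.Hom X}
    (h : ∀ u v, i u ≠ j v) (a : R.obj U) : R.res j (R.tr i a) = 0 := by
  rw [R.res_tr _ _ i j (isCartesian_of_disjoint i j h), R.tr_of_isEmpty]

theorem res_nm_of_disjoint {U V X : FinGSet.{u} G} {i : U.Hom X} {j : V.Hom X}
    (h : ∀ u v, i u ≠ j v) (hi : O.Admissible i) (a : R.obj U) : R.res j (R.nm i hi a) = 1 := by
  rw [R.res_nm _ _ i j (isCartesian_of_disjoint i j h), R.nm_of_isEmpty]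

theorem eq_tr_add_tr {U V X : FinGSet.{u} G} {i : U.Hom X} {j : V.Hom X}
    (h : IsDisjointCover i j) (a : R.obj X) :
    a = R.tr i (R.res i a) + R.tr j (R.res j a) := by
  refine R.ext_of_isDisjointCover h ?_ ?_
  · rw [map_add, R.res_tr_self i h.injective_left, R.res_tr_of_disjoint h.symm.ne, add_zero]
  · rw [map_add, R.res_tr_self j h.injective_right, R.res_tr_of_disjoint h.ne, zero_add]

/-- The norm along an inclusion extends an element by `1` outside its image, just as the transfer
extends it by `0`; both sides therefore have the same restrictions to `U` and `V`. -/
theorem eq_nm_mul_nm {U V X : FinGSet.{u} G} {i : U.Hom X} {j : V.Hom X}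
    (h : IsDisjointCover i j) (a : R.obj X) :
    a = R.nm i (O.admissible_of_injective i h.injective_left) (R.res i a) *
      R.nm j (O.admissible_of_injective j h.injective_right) (R.res j a) := by
  refine R.ext_of_isDisjointCover h ?_ ?_
  · rw [map_mul, R.res_nm_self i h.injective_left, R.res_nm_of_disjoint h.symm.ne, mul_one]
  · rw [map_mul, R.res_nm_self j h.injective_right, R.res_nm_of_disjoint h.ne, one_mul]

/-- The transfer of `a` along `f` is the sum of the transfers over the parts of a disjoint
cover. -/
theorem tr_eq_add {U V X Y : FinGSet.{u} G} {i : U.Hom X} {j : V.Hom X}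
    (h : IsDisjointCover i j) (f : X.Hom Y) (fi : U.Hom Y) (fj : V.Hom Y)
    (hi : ∀ u, f (i u) = fi u) (hj : ∀ v, f (j v) = fj v) (a : R.obj X) :
    R.tr f a = R.tr fi (R.res i a) + R.tr fj (R.res j a) := by
  conv_lhs => rw [R.eq_tr_add_tr h a]
  rw [map_add, R.tr_tr i f fi hi, R.tr_tr j f fj hj]

/-- The norm of `a` along `f` is the product of the norms over the parts of a disjoint cover. -/
theorem nm_eq_mul {U V X Y : FinGSet.{u} G} {i : U.Hom X} {j : V.Hom X}
    (h : IsDisjointCover i j) (f : X.Hom Y) (hf : O.Admissible f) (fi : U.Hom Y)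
    (fj : V.Hom Y) (hi : ∀ u, f (i u) = fi u) (hj : ∀ v, f (j v) = fj v)
    (hfi : O.Admissible fi) (hfj : O.Admissible fj) (a : R.obj X) :
    R.nm f hf a = R.nm fi hfi (R.res i a) * R.nm fj hfj (R.res j a) := by
  conv_lhs => rw [R.eq_nm_mul_nm h a]
  rw [map_mul, R.nm_nm i f fi hi _ hf hfi, R.nm_nm j f fj hj _ hf hfj]

theorem tr_of_bijective {X Y Z : FinGSet.{u} G} (k : X.Hom Y) (hk : Function.Bijective k)
    (f : Y.Hom Z) (g : X.Hom Z) (h : ∀ x, f (k x) = g x) (a : R.obj Y) :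
    R.tr f a = R.tr g (R.res k a) := by
  rw [R.tr_eq_add (isDisjointCover_of_bijective k hk) f g (fromEmpty Z) h fun v => isEmptyElim v,
    R.tr_of_isEmpty (fromEmpty Z), add_zero]

/-- The norm of zero along a surjective map vanishes. -/
theorem nm_zero_of_surjective {X Y : FinGSet.{u} G} (f : X.Hom Y) (hf : O.Admissible f)
    (hs : Function.Surjective f) : R.nm f hf 0 = 0 := by
  -- Zero is a transfer from the empty set, and a section of `∅ → X` over a nonempty fibre cannot
  -- exist. The dependent product in the Tambara relation is thus empty.
  have hE : IsEmpty (depProd (fromEmpty X) f) := ⟨fun s => by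
    obtain ⟨x, hx⟩ := hs (DepProdElt.base s)
    exact isEmptyElim (DepProdElt.sec s x hx)⟩
  rw [← map_zero (R.tr (fromEmpty X)), R.nm_tr, R.tr_of_isEmpty]

end TambaraFunctor

/-! ### Complements of diagonals: pullbacks, composites and dependent products -/

namespace FinGSet

variable {G : Type u} [Group G]

theorem IsCartesian.flip {P X Y Z : FinGSet.{u} G} {p : P.Hom X} {q : P.Hom Z} {f : X.Hom Y}
    {g : Z.Hom Y} (h : IsCartesian p q f g) : IsCartesian q p g f where
  comm w := (h.comm w).symm
  existsUnique z x hzx := by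
    obtain ⟨w, hw, hw'⟩ := h.existsUnique x z hzx.symm
    exact ⟨w, hw.symm, fun w' h' => hw' w' h'.symm⟩

/-- The diagonal `X → X ×_Y X`. -/
def diag {X Y : FinGSet.{u} G} (f : X.Hom Y) : X.Hom (fiberProd f f) where
  toFun x := ⟨(x, x), rfl⟩
  map_smul' _ _ := rfl

/-- The inclusion `X ×_Y X - Δ(X) → X ×_Y X`. -/
def offDiagIncl {X Y : FinGSet.{u} G} (f : X.Hom Y) : (offDiag f).Hom (fiberProd f f) where
  toFun p := ⟨p.1, p.2.1⟩
  map_smul' _ _ := rfl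

/-- Separates a point of a fibre from the remaining ones. Norms along `X ×_Y X → X` thereby factor
as the element itself times its cofactor. -/
theorem isDisjointCover_diag {X Y : FinGSet.{u} G} (f : X.Hom Y) :
    IsDisjointCover (diag f) (offDiagIncl f) where
  injective_left x y h := congrArg (fun z => z.1.1) h
  injective_right a b h := Subtype.ext (congrArg (fun z => z.1) h)
  ne x p h := p.2.2 ((congrArg (fun z => z.1.1) h).symm.trans (congrArg (fun z => z.1.2) h))
  cover z := by
    by_cases hz : z.1.1 = z.1.2
    · exact Or.inl ⟨z.1.1, Subtype.ext (Prod.ext rfl hz)⟩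
    · exact Or.inr ⟨⟨z.1, z.2, hz⟩, rfl⟩

/-- The map `P ×_Z P - Δ(P) → X ×_Y X - Δ(X)` induced by a pullback square. -/
def offDiagMap {P X Y Z : FinGSet.{u} G} {p : P.Hom X} {q : P.Hom Z} {f : X.Hom Y}
    {g : Z.Hom Y} (hc : IsCartesian p q f g) : (offDiag q).Hom (offDiag f) where
  toFun w := ⟨(p w.1.1, p w.1.2), by
    have h : q w.1.1 = q w.1.2 := w.2.1
    refine ⟨?_, fun h' => w.2.2 ?_⟩
    · change f (p w.1.1) = f (p w.1.2)
      rw [hc.comm, hc.comm, h]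
    · exact (hc.existsUnique (p w.1.1) (q w.1.1) (hc.comm _)).unique ⟨rfl, rfl⟩
        ⟨h'.symm, h.symm⟩⟩
  map_smul' γ w := Subtype.ext (Prod.ext (map_smul p γ w.1.1) (map_smul p γ w.1.2))

/-- In a pullback square, `p` maps the fibre of `q` through `w` bijectively onto the fibre of `f`
through `p(w)`, so the other points of the two fibres correspond. This gives base change for
cofactors. -/
theorem isCartesian_offDiagMap {P X Y Z : FinGSet.{u} G} {p : P.Hom X} {q : P.Hom Z} {f : X.Hom Y}
    {g : Z.Hom Y} (hc : IsCartesian p q f g) :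
    IsCartesian (offDiagMap hc) (offDiagFst q) (offDiagFst f) p where
  comm _ := rfl
  existsUnique x w hxw := by
    obtain ⟨⟨x, x'⟩, h, hne⟩ := x
    obtain rfl : x = p w := hxw
    have h : f (p w) = f x' := h
    obtain ⟨w', ⟨rfl, hw'⟩, hu⟩ := hc.existsUnique x' (q w) (h.symm.trans (hc.comm w))
    refine ⟨⟨(w, w'), hw'.symm, fun h' => hne (congrArg p h')⟩, ⟨rfl, rfl⟩, ?_⟩
    rintro ⟨⟨v, v'⟩, hv, hv'⟩ ⟨h1, h2⟩
    obtain rfl : v = w := h2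
    exact Subtype.ext (Prod.ext rfl (hu v' ⟨congrArg (fun z => z.1.2) h1, hv.symm⟩))

section Comp

variable {X Y Z : FinGSet.{u} G} (f : X.Hom Y) (g : Y.Hom Z)

/-- The pairs `(x, x')` over the same point of `Z` with `f(x) ≠ f(x')`. -/
def offDiagComp : FinGSet.{u} G :=
  (X.prod X).sub (fun p => g (f p.1) = g (f p.2) ∧ f p.1 ≠ f p.2)
    (fun γ p h => by
      change g (f (γ • p.1)) = g (f (γ • p.2)) ∧ f (γ • p.1) ≠ f (γ • p.2)
      simp only [map_smul]
      exact ⟨congrArg _ h.1, fun h' => h.2 (MulAction.injective γ h')⟩)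

/-- The first projection of `offDiagComp`. -/
def offDiagCompFst : (offDiagComp f g).Hom X where
  toFun p := p.1.1
  map_smul' _ _ := rfl

/-- The second projection of `offDiagComp`. -/
def offDiagCompSnd : (offDiagComp f g).Hom X where
  toFun p := p.1.2
  map_smul' _ _ := rfl

/-- The inclusion of `offDiagComp` into the complement of the diagonal of the composite. -/
def offDiagCompIncl : (offDiagComp f g).Hom (offDiag (X := X) (Y := Z) (MulActionHom.comp g f)) where
  toFun p := ⟨p.1, p.2.1, fun h => p.2.2 (congrArg f h)⟩
  map_smul' _ _ := rfl

/-- The inclusion of the complement of the diagonal of `f` into that of the composite. -/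
def offDiagCompLeft : (offDiag f).Hom (offDiag (X := X) (Y := Z) (MulActionHom.comp g f)) where
  toFun p := ⟨p.1, congrArg g p.2.1, p.2.2⟩
  map_smul' _ _ := rfl

/-- Another point `x'` of the `gf`-fibre of `x` either lies in a different `f`-fibre or is another
point of the same one. These cases are the two factors of the chain rule. -/
theorem isDisjointCover_offDiagComp :
    IsDisjointCover (offDiagCompIncl f g) (offDiagCompLeft f g) where
  injective_left a b h := Subtype.ext (congrArg (fun z => z.1) h)
  injective_right a b h := Subtype.ext (congrArg (fun z => z.1) h)
  ne a b h := by
    have h' : a.1 = b.1 := congrArg (fun z => z.1) h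
    refine a.2.2 ?_
    rw [h']
    exact b.2.1
  cover z := by
    by_cases hz : f z.1.1 = f z.1.2
    · exact Or.inr ⟨⟨z.1, hz, z.2.2⟩, rfl⟩
    · exact Or.inl ⟨⟨z.1, z.2.1, hz⟩, rfl⟩

/-- The map `(x, x') ↦ (x, f(x), f(x'))`. -/
def offDiagCompMap : (offDiagComp f g).Hom (fiberProd f (offDiagFst g)) where
  toFun p := ⟨(p.1.1, ⟨(f p.1.1, f p.1.2), p.2⟩), rfl⟩
  map_smul' γ p := Subtype.ext (Prod.ext rfl (Subtype.ext
    (Prod.ext (map_smul f γ p.1.1) (map_smul f γ p.1.2))))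

/-- Exhibits `offDiagComp` as a pullback of `f`. A norm over the points `x'` can then be taken in
two stages: first along the fibres of `f`, then over the points `y' ≠ f(x)`. -/
theorem isCartesian_offDiagCompMap :
    IsCartesian (offDiagCompSnd f g) (offDiagCompMap f g) f
      (Y := Y) (MulActionHom.comp (offDiagSnd g) (FinGSet.fiberProdSnd f (offDiagFst g))) where
  comm _ := rfl
  existsUnique x w h := by
    obtain ⟨⟨x₁, ⟨⟨y, y'⟩, hy⟩⟩, h1⟩ := w
    obtain rfl : f x₁ = y := h1
    obtain rfl : f x = y' := h
    refine ⟨⟨(x₁, x), hy⟩, ⟨rfl, rfl⟩, fun v hv => ?_⟩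
    exact Subtype.ext (Prod.ext (congrArg (fun z => z.1.1) hv.2) hv.1)

end Comp

section Exponential

variable {A X Y : FinGSet.{u} G} (h : A.Hom X) (g : X.Hom Y)

theorem map_depProdEval (z : fiberProd g (depProdBase h g)) :
    h (depProdEval h g z) = z.1.1 :=
  DepProdElt.isSection z.1.2 z.1.1 z.2

/-- The map `A ×_X (X ×_Y X - Δ(X)) → X`, `(a, x, x') ↦ x'`. -/
abbrev offDiagBaseChangeSnd : (fiberProd h (offDiagFst g)).Hom X :=
  MulActionHom.comp (offDiagSnd g) (FinGSet.fiberProdSnd h (offDiagFst g))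

/-- The map `A ×_X (X ×_Y X - Δ(X)) ×_X A → A ×_X (X ×_Y X - Δ(X))`. -/
abbrev offDiagBaseChange :
    (fiberProd h (offDiagBaseChangeSnd h g)).Hom (fiberProd h (offDiagFst g)) :=
  FinGSet.fiberProdSnd h (offDiagBaseChangeSnd h g)

/-- The target of `offDiagDepProdHom`. -/
abbrev offDiagDepProd : FinGSet.{u} G :=
  depProd (offDiagBaseChange h g) (FinGSet.fiberProdFst h (offDiagFst g))

/-- A pair of a point `x` and a section `s` is sent to `s(x)` and the restriction of `s` to the
complement of `x`. -/
def offDiagDepProdMk (z : fiberProd g (depProdBase h g)) : offDiagDepProd h g :=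
  { base := depProdEval h g z
    sec := fun w hw => ⟨(DepProdElt.sec z.1.2 w.1.2.1.2 (by
        have h1 : w.1.1 = depProdEval h g z := hw
        have h2 : h w.1.1 = w.1.2.1.1 := w.2
        have h3 : g w.1.2.1.1 = g w.1.2.1.2 := w.1.2.2.1
        rw [← h3, ← h2, h1, map_depProdEval]
        exact z.2), w), DepProdElt.isSection _ _ _⟩
    isSection := fun _ _ => rfl :
    DepProdElt (offDiagBaseChange h g) (FinGSet.fiberProdFst h (offDiagFst g)) }

/-- The comparison map `X ×_Y ∏_g A → ∏_{ρ} C`, where `ρ : A ×_X (X ×_Y X - Δ(X)) → A` and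
`C = A ×_X (X ×_Y X - Δ(X)) ×_X A`. -/
def offDiagDepProdHom : (fiberProd g (depProdBase h g)).Hom (offDiagDepProd h g) where
  toFun := offDiagDepProdMk h g
  map_smul' γ z := by
    refine DepProdElt.ext' (map_smul (depProdEval h g) γ z) fun w hw hw' => ?_
    exact Subtype.ext (Prod.ext rfl (smul_inv_smul γ w).symm)

/-- A section over a fibre with a chosen point `x` amounts to its value at `x` together with its
values at the other points. The point `x` need not be recorded, being the image under `h` of the
value. -/
theorem bijective_offDiagDepProdHom : Function.Bijective (offDiagDepProdHom h g) := by
  classical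
  constructor
  · rintro ⟨⟨x, s⟩, hz⟩ ⟨⟨x', s'⟩, hz'⟩ e
    have e0 : depProdEval h g ⟨(x, s), hz⟩ = depProdEval h g ⟨(x', s'), hz'⟩ :=
      congrArg DepProdElt.base e
    obtain rfl : x = x' :=
      (map_depProdEval h g _).symm.trans ((congrArg h e0).trans (map_depProdEval h g _))
    have hs : DepProdElt.base s = DepProdElt.base s' := Eq.trans (Eq.symm hz) hz'
    refine Subtype.ext (Prod.ext rfl (DepProdElt.ext' hs fun x' hx hx' => ?_))
    by_cases hxx : x' = x
    · subst hxx
      exact e0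
    -- The two sections have base points that are equal only propositionally; stating the comparison
    -- for arbitrary equal `t`, `t'` allows a substitution.
    · have key : ∀ t t' : offDiagDepProd h g, t = t' → ∀ (w : fiberProd h (offDiagFst g))
          (hw : FinGSet.fiberProdFst h (offDiagFst g) w = DepProdElt.base t)
          (hw' : FinGSet.fiberProdFst h (offDiagFst g) w = DepProdElt.base t'),
          (DepProdElt.sec t w hw).1.1 = (DepProdElt.sec t' w hw').1.1 := by
        rintro t _ rfl w _ _
        rfl
      exact key _ _ e ⟨(depProdEval h g ⟨(x, s), hz⟩, ⟨(x, x'), Eq.trans hz (Eq.symm hx),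
        fun h => hxx h.symm⟩), map_depProdEval h g ⟨(x, s), hz⟩⟩ rfl e0
  · intro t
    -- The preimage has chosen point `h a` and takes the value `a` there; at every other point of
    -- the fibre its value is read off from `t`.
    let a : A := DepProdElt.base t
    let w (x : X) (hx : g x = g (h a)) (hne : ¬ x = h a) : fiberProd h (offDiagFst g) :=
      ⟨(a, ⟨(h a, x), hx.symm, fun e => hne e.symm⟩), rfl⟩
    let s : DepProdElt h g :=
      { base := g (h a)
        sec := fun x hx => if e : x = h a then a else (DepProdElt.sec t (w x hx e) rfl).1.1
        isSection := fun x hx => by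
          split_ifs with e
          · exact e.symm
          · refine ((DepProdElt.sec t (w x hx e) rfl).2).trans ?_
            exact congrArg (offDiagBaseChangeSnd h g) (DepProdElt.isSection t (w x hx e) rfl) }
    have hb : depProdEval h g ⟨(h a, s), rfl⟩ = a := dif_pos rfl
    refine ⟨⟨(h a, s), rfl⟩, DepProdElt.ext' hb fun v hv hv' => ?_⟩
    refine Subtype.ext (Prod.ext ?_ (DepProdElt.isSection t v hv').symm)
    obtain ⟨⟨a', ⟨⟨x, x'⟩, hx, hne⟩⟩, hax⟩ := v
    obtain rfl : a' = a := hv'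
    obtain rfl : h a = x := hax
    exact dif_neg fun e => hne e.symm

/-- The map `((x, s), (x', s)) ↦ ((s(x), x, x'), (x, s))`. -/
def offDiagDepProdLift : (offDiag (depProdSnd h g)).Hom
    (fiberProd (FinGSet.fiberProdFst h (offDiagFst g))
      (depProdBase (offDiagBaseChange h g) (FinGSet.fiberProdFst h (offDiagFst g)))) where
  toFun z := ⟨(⟨(depProdEval h g z.1.1, ⟨(z.1.1.1.1, z.1.2.1.1), by
      have h1 : z.1.1.1.2 = z.1.2.1.2 := z.2.1
      have h2 : g z.1.1.1.1 = depProdBase h g z.1.1.1.2 := z.1.1.2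
      have h3 : g z.1.2.1.1 = depProdBase h g z.1.2.1.2 := z.1.2.2
      refine ⟨?_, fun h4 => z.2.2 (Subtype.ext (Prod.ext h4 h1))⟩
      change g z.1.1.1.1 = g z.1.2.1.1
      rw [h2, h3, h1]⟩), map_depProdEval h g z.1.1⟩, offDiagDepProdHom h g z.1.1), rfl⟩
  map_smul' γ z := by
    refine Subtype.ext (Prod.ext (Subtype.ext (Prod.ext ?_ rfl)) ?_)
    · exact map_smul (depProdEval h g) γ z.1.1
    · exact map_smul (offDiagDepProdHom h g) γ z.1.1

/-- Identifies the points over which the norm in the exponential diagram of `ρ` is taken with the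
other points of the fibre of `depProdSnd h g`, so that norm becomes a cofactor. -/
theorem isCartesian_offDiagDepProdLift :
    IsCartesian (offDiagDepProdLift h g) (offDiagFst (depProdSnd h g))
      (depProdSnd (offDiagBaseChange h g) (FinGSet.fiberProdFst h (offDiagFst g)))
      (offDiagDepProdHom h g) where
  comm _ := rfl
  existsUnique t z e := by
    obtain ⟨⟨⟨⟨a, ⟨⟨x, x'⟩, hx, hne⟩⟩, hax⟩, t⟩, ht⟩ := t
    obtain rfl : t = offDiagDepProdHom h g z := e
    obtain rfl : a = depProdEval h g z := ht
    obtain rfl : z.1.1 = x := (map_depProdEval h g z).symm.trans hax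
    refine ⟨⟨(z, ⟨(x', z.1.2), Eq.trans (Eq.symm hx) z.2⟩), rfl,
      fun e => hne (congrArg (fun z => z.1.1) e)⟩, ⟨rfl, rfl⟩, ?_⟩
    rintro ⟨⟨v, v'⟩, hv, hv'⟩ ⟨h1, h2⟩
    obtain rfl : v = z := h2
    have h3 : v'.1.1 = x' := congrArg (fun z => z.1.1.1.2.1.2) h1
    exact Subtype.ext (Prod.ext rfl (Subtype.ext (Prod.ext h3 (Eq.symm hv))))

end Exponential

end FinGSet

/-! ### The calculus of cofactors -/

namespace TambaraFunctor

variable {G : Type u} [Group G] [Finite G] {O : IndexingSystem.{u} G} (R : TambaraFunctor.{u, v} O)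

/-- The element `N_{π₁} R_{π₂}(b)`, the product over the other points of the fibre. -/
def cofactor {X Y : FinGSet.{u} G} (f : X.Hom Y) (hf : O.Admissible f) : R.obj X →* R.obj X :=
  (R.nm (offDiagFst f) hf.offDiagFst).comp (R.res (offDiagSnd f) : R.obj X →* _)

theorem cofactor_apply {X Y : FinGSet.{u} G} (f : X.Hom Y) (hf : O.Admissible f) (b : R.obj X) :
    R.cofactor f hf b = R.nm (offDiagFst f) hf.offDiagFst (R.res (offDiagSnd f) b) :=
  rfl

/-- By the double coset formula the left side is a norm along the projection `X ×_Y X → X`; the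
diagonal contributes `b` and its complement the cofactor. -/
theorem res_nm_eq_mul_cofactor {X Y : FinGSet.{u} G} (f : X.Hom Y) (hf : O.Admissible f)
    (b : R.obj X) : R.res f (R.nm f hf b) = b * R.cofactor f hf b := by
  rw [R.res_nm _ _ f f (isCartesian_fiberProd f f).flip hf,
    R.nm_eq_mul (isDisjointCover_diag f) _ _ (MulActionHom.id G) (offDiagFst f) (fun _ => rfl)
      (fun _ => rfl) (O.admissible_id X) hf.offDiagFst, R.nm_id, R.res_res _ _
      (MulActionHom.id G) (fun _ => rfl), R.res_id, R.res_res _ _ (offDiagSnd f) fun _ => rfl]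
  rfl

theorem cofactor_id (X : FinGSet.{u} G) (b : R.obj X) :
    R.cofactor (MulActionHom.id G) (O.admissible_id X) b = 1 := by
  have : IsEmpty (offDiag (X := X) (Y := X) (MulActionHom.id G)) := ⟨fun p => p.2.2 p.2.1⟩
  exact R.nm_of_isEmpty _ _ _

theorem res_cofactor {P X Y Z : FinGSet.{u} G} (p : P.Hom X) (q : P.Hom Z) (f : X.Hom Y)
    (g : Z.Hom Y) (hc : IsCartesian p q f g) (hf : O.Admissible f) (b : R.obj X) :
    R.res p (R.cofactor f hf b) = R.cofactor q (hf.of_isCartesian hc) (R.res p b) := by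
  rw [cofactor_apply, cofactor_apply, R.res_nm _ _ _ _ (isCartesian_offDiagMap hc),
    R.res_res_comm (offDiagMap hc) (offDiagSnd f) (offDiagSnd q) p fun _ => rfl]

/-- The chain rule. The points in other `f`-fibres contribute the first factor, and the other points
of the same `f`-fibre the second. -/
theorem cofactor_comp {X Y Z : FinGSet.{u} G} (f : X.Hom Y) (g : Y.Hom Z) (hf : O.Admissible f)
    (hg : O.Admissible g) (b : R.obj X) :
    R.cofactor (X := X) (Y := Z) (MulActionHom.comp g f) (hg.comp hf) b =
      R.res f (R.cofactor g hg (R.nm f hf b)) * R.cofactor f hf b := by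
  have hq := hg.offDiagFst.of_isCartesian (isCartesian_fiberProd f (offDiagFst g)).flip
  have hq' := hf.of_isCartesian (isCartesian_offDiagCompMap f g)
  have hW : O.Admissible (offDiagCompFst f g) := (hq.comp hq').congr fun _ => rfl
  rw [cofactor_apply, R.nm_eq_mul (isDisjointCover_offDiagComp f g) _ _ (offDiagCompFst f g)
    (offDiagFst f) (fun _ => rfl) (fun _ => rfl) hW hf.offDiagFst,
    R.res_res _ _ (offDiagSnd f) fun _ => rfl, R.res_res _ _ (offDiagCompSnd f g) fun _ => rfl,
    cofactor_apply, cofactor_apply, R.res_nm _ _ _ _ (isCartesian_fiberProd f (offDiagFst g)).flip,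
    ← R.res_comp, R.res_nm _ _ _ _ (isCartesian_offDiagCompMap f g),
    R.nm_nm _ _ (offDiagCompFst f g) (fun _ => rfl) _ _ hW]

/-- Fibres with at least two elements are exactly what makes `π₁` surjective on the complement of
the diagonal, and norms along surjections kill zero. -/
theorem cofactor_zero_of_twoSurjective {X Y : FinGSet.{u} G} (f : X.Hom Y) (hf : O.Admissible f)
    (h : TwoSurjective f) : R.cofactor f hf 0 = 0 := by
  rw [cofactor_apply, map_zero]
  refine R.nm_zero_of_surjective _ _ fun x => ?_
  obtain ⟨x', hx', hne⟩ := (h (f x)).exists_ne x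
  exact ⟨⟨(x, x'), Eq.symm hx', hne.symm⟩, rfl⟩

/-- The formula for `N_{π₁} R_{π₂} T_h`, which comes from the exponential diagram of
`A ×_X (X ×_Y X - Δ(X)) ×_X A → A ×_X (X ×_Y X - Δ(X)) → A`. -/
theorem res_cofactor_tr {A X Y : FinGSet.{u} G} (h : A.Hom X) (g : X.Hom Y) (hg : O.Admissible g)
    (b : R.obj A) :
    R.res h (R.cofactor g hg (R.tr h b)) = R.tr (depProdEval h g)
      (R.cofactor (depProdSnd h g) (hg.depProdSnd h) (R.res (depProdEval h g) b)) := by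
  rw [cofactor_apply, R.res_nm _ _ _ _ (isCartesian_fiberProd h (offDiagFst g)).flip,
    ← R.res_comp, R.res_tr _ _ _ _ (isCartesian_fiberProd h (offDiagBaseChangeSnd h g)), R.nm_tr,
    R.tr_of_bijective (offDiagDepProdHom h g) (bijective_offDiagDepProdHom h g) _
      (depProdEval h g) (fun _ => rfl), R.res_nm _ _ _ _ (isCartesian_offDiagDepProdLift h g),
    cofactor_apply]
  refine congrArg (fun c => R.tr (depProdEval h g) (R.nm _ _ c)) ?_
  rw [← R.res_comp, ← R.res_comp, ← R.res_comp]
  -- Both composites send `((x, s), (x', s))` to `s(x')`.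
  refine R.res_congr ?_ b
  rintro ⟨⟨⟨⟨x, s⟩, hx⟩, ⟨⟨x', s'⟩, hx'⟩⟩, h1, h2⟩
  obtain rfl : s = s' := h1
  rfl

end TambaraFunctor

/-! ### The square-zero extension as a Tambara functor -/

variable {G : Type u} [Group G] [Finite G] {O : IndexingSystem.{u} G}

/-- The underlying set of the square-zero extension `B ⋉ M` at `X`. -/
@[ext]
structure SqZero {B : TambaraFunctor.{u, v} O} (M : TambaraModule.{u, v} B) (X : FinGSet.{u} G) :
    Type v where
  base : B.obj X
  val : M.obj X

namespace SqZero

variable {B : TambaraFunctor.{u, v} O} (M : TambaraModule.{u, v} B)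

instance (X : FinGSet.{u} G) : AddCommGroup (SqZero M X) :=
  letI : Add (SqZero M X) := ⟨fun x y => ⟨x.base + y.base, x.val + y.val⟩⟩
  letI : Zero (SqZero M X) := ⟨⟨0, 0⟩⟩
  letI : Neg (SqZero M X) := ⟨fun x => ⟨-x.base, -x.val⟩⟩
  { add_assoc := fun _ _ _ => SqZero.ext (add_assoc _ _ _) (add_assoc _ _ _)
    zero_add := fun _ => SqZero.ext (zero_add _) (zero_add _)
    add_zero := fun _ => SqZero.ext (add_zero _) (add_zero _)
    add_comm := fun _ _ => SqZero.ext (add_comm _ _) (add_comm _ _)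
    neg_add_cancel := fun _ => SqZero.ext (neg_add_cancel _) (neg_add_cancel _)
    nsmul := nsmulRec
    zsmul := zsmulRec }

instance (X : FinGSet.{u} G) : CommRing (SqZero M X) where
  mul x y := ⟨x.base * y.base, x.base • y.val + y.base • x.val⟩
  one := ⟨1, 0⟩
  __ := (inferInstance : AddCommGroup (SqZero M X))
  mul_assoc x y z := SqZero.ext (mul_assoc _ _ _) (by
    change (x.base * y.base) • z.val + z.base • (x.base • y.val + y.base • x.val)
      = x.base • (y.base • z.val + z.base • y.val) + (y.base * z.base) • x.val
    module)
  one_mul x := SqZero.ext (one_mul _) (by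
    change (1 : B.obj X) • x.val + x.base • (0 : M.obj X) = x.val
    rw [one_smul, smul_zero, add_zero])
  mul_one x := SqZero.ext (mul_one _) (by
    change x.base • (0 : M.obj X) + (1 : B.obj X) • x.val = x.val
    rw [one_smul, smul_zero, zero_add])
  zero_mul x := SqZero.ext (zero_mul _) (by
    change (0 : B.obj X) • x.val + x.base • (0 : M.obj X) = 0
    rw [zero_smul, smul_zero, zero_add])
  mul_zero x := SqZero.ext (mul_zero _) (by
    change x.base • (0 : M.obj X) + (0 : B.obj X) • x.val = 0
    rw [zero_smul, smul_zero, zero_add])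
  mul_comm x y := SqZero.ext (mul_comm _ _) (add_comm _ _)
  left_distrib x y z := SqZero.ext (mul_add _ _ _) (by
    change x.base • (y.val + z.val) + (y.base + z.base) • x.val
      = (x.base • y.val + y.base • x.val) + (x.base • z.val + z.base • x.val)
    module)
  right_distrib x y z := SqZero.ext (add_mul _ _ _) (by
    change (x.base + y.base) • z.val + z.base • (x.val + y.val)
      = (x.base • z.val + z.base • x.val) + (y.base • z.val + z.base • y.val)
    module)

/-- The restrictions of `B ⋉ M`. -/
def res {X Y : FinGSet.{u} G} (f : X.Hom Y) : SqZero M Y →+* SqZero M X where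
  toFun x := ⟨B.res f x.base, M.res f x.val⟩
  map_one' := SqZero.ext (map_one _) (map_zero _)
  map_mul' x y := SqZero.ext (map_mul _ _ _) (by
    change M.res f (x.base • y.val + y.base • x.val)
      = B.res f x.base • M.res f y.val + B.res f y.base • M.res f x.val
    rw [map_add, M.res_smul, M.res_smul])
  map_zero' := SqZero.ext (map_zero _) (map_zero _)
  map_add' _ _ := SqZero.ext (map_add _ _ _) (map_add _ _ _)

/-- The transfers of `B ⋉ M`. -/
def tr {X Y : FinGSet.{u} G} (f : X.Hom Y) : SqZero M X →+ SqZero M Y where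
  toFun x := ⟨B.tr f x.base, M.tr f x.val⟩
  map_zero' := SqZero.ext (map_zero _) (map_zero _)
  map_add' _ _ := SqZero.ext (map_add _ _ _) (map_add _ _ _)

/-- The norms of `B ⋉ M`. -/
def nm {X Y : FinGSet.{u} G} (f : X.Hom Y) (hf : O.Admissible f) :
    SqZero M X →* SqZero M Y where
  toFun x := ⟨B.nm f hf x.base, M.tr f (B.cofactor f hf x.base • x.val)⟩
  map_one' := SqZero.ext (map_one _) (by
    change M.tr f (_ • (0 : M.obj X)) = 0
    rw [smul_zero, map_zero])
  map_mul' x y := SqZero.ext (map_mul _ _ _) (by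
    change M.tr f (B.cofactor f hf (x.base * y.base) • (x.base • y.val + y.base • x.val))
      = B.nm f hf x.base • M.tr f (B.cofactor f hf y.base • y.val)
        + B.nm f hf y.base • M.tr f (B.cofactor f hf x.base • x.val)
    -- Moving `N_f(b)` inside the transfer turns it into `R_f N_f(b) = b * c_f(b)`, which supplies
    -- the missing factor on each summand.
    rw [M.smul_tr, M.smul_tr, ← map_add, B.res_nm_eq_mul_cofactor, B.res_nm_eq_mul_cofactor,
      map_mul]
    congr 1
    module)

end SqZero

/-- The square-zero extension `B ⋉ M`. -/
def sqZeroTambara {B : TambaraFunctor.{u, v} O} (M : TambaraModule.{u, v} B) :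
    TambaraFunctor.{u, v} O where
  obj := SqZero M
  res := SqZero.res M
  tr := SqZero.tr M
  nm := SqZero.nm M
  res_id X _ := SqZero.ext (B.res_id X _) (M.res_id X _)
  res_comp f g _ := SqZero.ext (B.res_comp f g _) (M.res_comp f g _)
  tr_id X _ := SqZero.ext (B.tr_id X _) (M.tr_id X _)
  tr_comp f g _ := SqZero.ext (B.tr_comp f g _) (M.tr_comp f g _)
  -- In the module component, each axiom on norms reduces to the corresponding identity for
  -- cofactors.
  nm_id X x := SqZero.ext (B.nm_id X _) (by
    change M.tr _ (B.cofactor _ _ x.base • x.val) = x.val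
    rw [B.cofactor_id, one_smul]
    exact M.tr_id X _)
  nm_comp f g hf hg x := SqZero.ext (B.nm_comp f g hf hg _) (by
    change M.tr _ (B.cofactor _ _ x.base • x.val)
      = M.tr g (B.cofactor g hg (B.nm f hf x.base) • M.tr f (B.cofactor f hf x.base • x.val))
    rw [B.cofactor_comp, M.smul_tr, smul_smul]
    exact M.tr_comp f g _)
  res_tr p q f g hc _ := SqZero.ext (B.res_tr p q f g hc _) (M.res_tr p q f g hc _)
  res_nm p q f g hc hf x := SqZero.ext (B.res_nm p q f g hc hf _) (by
    change M.res g (M.tr f (B.cofactor f hf x.base • x.val))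
      = M.tr q (B.cofactor q _ (B.res p x.base) • M.res p x.val)
    rw [M.res_tr p q f g hc, M.res_smul, B.res_cofactor p q f g hc])
  tr_mul f x y := SqZero.ext (B.tr_mul f _ _) (by
    change B.tr f x.base • y.val + y.base • M.tr f x.val
      = M.tr f (x.base • M.res f y.val + B.res f y.base • x.val)
    rw [M.tr_smul, M.smul_tr, map_add])
  nm_tr h g hg x := SqZero.ext (B.nm_tr h g hg _) (by
    change M.tr g (B.cofactor g hg (B.tr h x.base) • M.tr h x.val)
      = M.tr (depProdBase h g) (M.tr (depProdSnd h g)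
        (B.cofactor _ _ (B.res (depProdEval h g) x.base) • M.res (depProdEval h g) x.val))
    -- Frobenius reciprocity is applied twice: once to bring the cofactor under `T_h`, and once to
    -- bring `m` under the transfer along the evaluation map produced by `res_cofactor_tr`. It
    -- remains to see that two composites to `Y` agree.
    rw [M.smul_tr, B.res_cofactor_tr, M.tr_smul, M.tr_tr h g (MulActionHom.comp g h) fun _ => rfl,
      M.tr_tr (depProdSnd h g) (depProdBase h g)
      (MulActionHom.comp (depProdBase h g) (depProdSnd h g)) fun _ => rfl]
    refine M.tr_tr _ _ _ (fun z => ?_) _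
    exact (congrArg g (map_depProdEval h g z)).trans z.2)
  subsingleton_of_isEmpty X hX := by
    have := B.subsingleton_of_isEmpty X hX
    have := M.subsingleton_of_isEmpty X hX
    exact ⟨fun _ _ => SqZero.ext (Subsingleton.elim _ _) (Subsingleton.elim _ _)⟩
  bijective_sum X Y := by
    constructor
    · intro x y h
      exact SqZero.ext
        ((B.bijective_sum X Y).1 (Prod.ext (congrArg (fun z => z.1.base) h)
          (congrArg (fun z => z.2.base) h)))
        ((M.bijective_sum X Y).1 (Prod.ext (congrArg (fun z => z.1.val) h)
          (congrArg (fun z => z.2.val) h)))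
    · rintro ⟨x, y⟩
      obtain ⟨b, hb⟩ := (B.bijective_sum X Y).2 (x.base, y.base)
      obtain ⟨m, hm⟩ := (M.bijective_sum X Y).2 (x.val, y.val)
      exact ⟨⟨b, m⟩, Prod.ext
        (SqZero.ext (congrArg Prod.fst hb) (congrArg Prod.fst hm))
        (SqZero.ext (congrArg Prod.snd hb) (congrArg Prod.snd hm))⟩

/-! ### The square-zero extension as an abelian group object -/

section Augmented

open MonoidalCategory CartesianMonoidalCategory MonObj

variable {A B : TambaraFunctor.{u, v} O}

namespace SqZero

variable (M : TambaraModule.{u, v} B)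

/-- The augmentation `B ⋉ M → B`. -/
def augHom : sqZeroTambara M ⟶ B where
  app _ :=
    { toFun := SqZero.base
      map_one' := rfl
      map_mul' := fun _ _ => rfl
      map_zero' := rfl
      map_add' := fun _ _ => rfl }
  app_res _ _ := rfl
  app_tr _ _ := rfl
  app_nm _ _ _ := rfl

/-- The section `B → B ⋉ M`. -/
def unitHom : B ⟶ sqZeroTambara M where
  app X :=
    { toFun := fun b => (⟨b, 0⟩ : SqZero M X)
      map_one' := rfl
      map_mul' := fun b c => SqZero.ext rfl (by
        change (0 : M.obj X) = b • (0 : M.obj X) + c • (0 : M.obj X)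
        rw [smul_zero, smul_zero, add_zero])
      map_zero' := rfl
      map_add' := fun b c => SqZero.ext rfl (add_zero (0 : M.obj X)).symm }
  app_res f _ := SqZero.ext rfl (map_zero (M.res f)).symm
  app_tr f _ := SqZero.ext rfl (map_zero (M.tr f)).symm
  app_nm {X Y} f hf b := SqZero.ext rfl (by
    change (0 : M.obj Y) = M.tr f (_ • (0 : M.obj X))
    rw [smul_zero, map_zero])

/-- The addition `(B ⋉ M) ×_B (B ⋉ M) → B ⋉ M`. -/
def addHom : TambaraFunctor.fiberProd (augHom M) (augHom M) ⟶ sqZeroTambara M where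
  app X :=
    { toFun := fun z => (⟨z.1.1.base, z.1.1.val + z.1.2.val⟩ : SqZero M X)
      map_one' := SqZero.ext rfl (add_zero (0 : M.obj X))
      map_mul' := by
        rintro ⟨⟨⟨b, m⟩, ⟨b', m'⟩⟩, hb⟩ ⟨⟨⟨c, n⟩, ⟨c', n'⟩⟩, hc⟩
        obtain rfl : b = b' := hb
        obtain rfl : c = c' := hc
        refine SqZero.ext rfl ?_
        change b • n + c • m + (b • n' + c • m') = b • (n + n') + c • (m + m')
        module
      map_zero' := SqZero.ext rfl (add_zero (0 : M.obj X))
      map_add' := fun z w => SqZero.ext rfl (add_add_add_comm z.1.1.val w.1.1.val _ _) }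
  app_res f z := SqZero.ext rfl (map_add (M.res f) _ _).symm
  app_tr f z := SqZero.ext rfl (map_add (M.tr f) _ _).symm
  app_nm {X Y} f hf := by
    rintro ⟨⟨⟨b, m⟩, ⟨b', m'⟩⟩, hb⟩
    obtain rfl : b = b' := hb
    refine SqZero.ext rfl ?_
    change M.tr f (B.cofactor f hf b • m) + M.tr f (B.cofactor f hf b • m')
      = M.tr f (B.cofactor f hf b • (m + m'))
    rw [smul_add, map_add]

variable {M} in
/-- The map `B ⋉ M → B ⋉ N` induced by a map of modules. -/
def mapHom {N : TambaraModule.{u, v} B} (g : M ⟶ N) : sqZeroTambara M ⟶ sqZeroTambara N where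
  app X :=
    { toFun := fun (x : SqZero M X) => (⟨x.base, TambaraModule.app g X x.val⟩ : SqZero N X)
      map_one' := SqZero.ext rfl (map_zero (TambaraModule.app g X))
      map_mul' := fun (x y : SqZero M X) => SqZero.ext rfl (by
        change TambaraModule.app g X (x.base • y.val + y.base • x.val)
          = x.base • TambaraModule.app g X y.val + y.base • TambaraModule.app g X x.val
        rw [map_add, map_smul, map_smul])
      map_zero' := SqZero.ext rfl (map_zero (TambaraModule.app g X))
      map_add' := fun _ _ => SqZero.ext rfl (map_add (TambaraModule.app g X) _ _) }
  app_res f x := SqZero.ext rfl (TambaraModule.Hom.app_res g f _)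
  app_tr f x := SqZero.ext rfl (TambaraModule.Hom.app_tr g f _)
  app_nm {X Y} f hf := fun (x : SqZero M X) => SqZero.ext rfl (by
    change TambaraModule.app g Y (M.tr f (B.cofactor f hf x.base • x.val))
      = N.tr f (B.cofactor f hf x.base • TambaraModule.app g X x.val)
    rw [TambaraModule.Hom.app_tr, map_smul])

/-- The negation of a module. -/
def negHom : M ⟶ M where
  app _ := -LinearMap.id
  app_res f _ := (map_neg (M.res f) _).symm
  app_tr f _ := (map_neg (M.tr f) _).symm

end SqZero

variable (φ : A ⟶ B) (M : TambaraModule.{u, v} B)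

/-- The object `A → B ⋉ M → B` of `A-CAlg/B`. -/
def sqZeroAug : AugCAlg φ :=
  AugCAlg.mk (sqZeroTambara M) (φ ≫ SqZero.unitHom M) (SqZero.augHom M) rfl

/-- Replaces the abstract map to the terminal object by the augmentation, so that the inverse laws
can be checked on elements. -/
theorem AugCAlg.toUnit_eq {φ : A ⟶ B} (R : AugCAlg φ) :
    toUnit R = AugCAlg.homMk (S := 𝟙_ (AugCAlg φ)) R.aug R.alg_aug rfl :=
  toUnit_unique _ _

noncomputable instance : GrpObj (sqZeroAug φ M) where
  one := AugCAlg.homMk (R := 𝟙_ (AugCAlg φ)) (S := sqZeroAug φ M) (SqZero.unitHom M) rfl rfl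
  mul := AugCAlg.homMk (R := sqZeroAug φ M ⊗ sqZeroAug φ M) (S := sqZeroAug φ M) (SqZero.addHom M)
    (TambaraFunctor.hom_ext fun X _ => SqZero.ext rfl (add_zero (0 : M.obj X))) rfl
  inv := AugCAlg.homMk (R := sqZeroAug φ M) (S := sqZeroAug φ M) (SqZero.mapHom (SqZero.negHom M))
    (TambaraFunctor.hom_ext fun X _ => SqZero.ext rfl (neg_zero (G := M.obj X))) rfl
  -- The sum takes its `B`-component from the first summand; `z.2` says that the two summands have
  -- the same image in `B`.
  one_mul := AugCAlg.hom_ext (TambaraFunctor.hom_ext fun X z =>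
    SqZero.ext z.2 (zero_add (M := M.obj X) _))
  mul_one := AugCAlg.hom_ext (TambaraFunctor.hom_ext fun X z =>
    SqZero.ext rfl (add_zero (M := M.obj X) _))
  mul_assoc := AugCAlg.hom_ext (TambaraFunctor.hom_ext fun X z =>
    SqZero.ext rfl (add_assoc (G := M.obj X) _ _ _))
  left_inv := by
    rw [AugCAlg.toUnit_eq]
    exact AugCAlg.hom_ext (TambaraFunctor.hom_ext fun X z =>
      SqZero.ext rfl (neg_add_cancel (G := M.obj X) _))
  right_inv := by
    rw [AugCAlg.toUnit_eq]
    exact AugCAlg.hom_ext (TambaraFunctor.hom_ext fun X z =>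
      SqZero.ext rfl (add_neg_cancel (G := M.obj X) _))

/-- The braiding is determined by its composites with the two projections, which give the two
components. -/
theorem AugCAlg.braiding_apply (R S : AugCAlg φ) (X : FinGSet.{u} G)
    (z : (R ⊗ S).toTambara.obj X) :
    (TambaraFunctor.app (AugCAlg.homTambara (β_ R S).hom) X z).1 = (z.1.2, z.1.1) :=
  Prod.ext
    (congrArg (fun f => TambaraFunctor.app (AugCAlg.homTambara f) X z)
      (braiding_hom_fst R S))
    (congrArg (fun f => TambaraFunctor.app (AugCAlg.homTambara f) X z)
      (braiding_hom_snd R S))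

theorem sqZeroAug_mul_apply (X : FinGSet.{u} G)
    (z : (sqZeroAug φ M ⊗ sqZeroAug φ M).toTambara.obj X) :
    TambaraFunctor.app (AugCAlg.homTambara μ[sqZeroAug φ M]) X z =
      (⟨(z.1.1 : SqZero M X).base, (z.1.1 : SqZero M X).val + (z.1.2 : SqZero M X).val⟩ :
        SqZero M X) :=
  rfl

instance : IsCommMonObj (sqZeroAug φ M) where
  mul_comm := AugCAlg.hom_ext (TambaraFunctor.hom_ext fun X z =>
    SqZero.ext z.2.symm (add_comm (G := M.obj X) _ _))

instance : IsCommMonObj (sqZeroAug φ M) where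
  mul_comm := AugCAlg.hom_ext (TambaraFunctor.hom_ext fun X z => by
    change TambaraFunctor.app (AugCAlg.homTambara μ[sqZeroAug φ M]) X
      (TambaraFunctor.app (AugCAlg.homTambara (β_ (sqZeroAug φ M) (sqZeroAug φ M)).hom) X z) = _
    rw [sqZeroAug_mul_apply, sqZeroAug_mul_apply, AugCAlg.braiding_apply]
    exact SqZero.ext z.2.symm (add_comm (G := M.obj X) _ _))

/-- The square-zero extension `B ⋉ M` as an abelian group object of `A-CAlg/B`. -/
noncomputable def sqZeroGrp : CommGrp (AugCAlg φ) := ⟨sqZeroAug φ M⟩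

/-- On the kernel `b = 0`, so the norm is `(N_f(0), T_f(c_f(0) • m))`. The first entry vanishes
because `f` is surjective, the second because `c_f(0) = 0`. -/
theorem normsVanish_sqZeroGrp : normsVanish φ (sqZeroGrp φ M) := by
  intro X Y f hf h2 r hr
  obtain ⟨b, m⟩ := r
  obtain rfl : b = 0 := hr
  refine SqZero.ext (B.nm_zero_of_surjective f hf fun y => ?_) ?_
  · obtain ⟨x, hx⟩ := (h2 y).nonempty
    exact ⟨x, hx⟩
  · change M.tr f (B.cofactor f hf 0 • m) = 0
    rw [B.cofactor_zero_of_twoSurjective f hf h2, zero_smul, map_zero]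

variable {M} in
/-- The map `B ⋉ M → B ⋉ N` in `A-CAlg/B` induced by a map of modules. -/
def sqZeroAugMap {N : TambaraModule.{u, v} B} (g : M ⟶ N) : sqZeroAug φ M ⟶ sqZeroAug φ N :=
  AugCAlg.homMk (R := sqZeroAug φ M) (S := sqZeroAug φ N) (SqZero.mapHom g)
    (TambaraFunctor.hom_ext fun X _ => SqZero.ext rfl (map_zero (TambaraModule.app g X))) rfl

instance {N : TambaraModule.{u, v} B} (g : M ⟶ N) : IsMonHom (sqZeroAugMap φ g) where
  one_hom := AugCAlg.hom_ext (TambaraFunctor.hom_ext fun X _ =>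
    SqZero.ext rfl (map_zero (TambaraModule.app g X)))
  mul_hom := AugCAlg.hom_ext (TambaraFunctor.hom_ext fun X _ =>
    SqZero.ext rfl (map_add (TambaraModule.app g X) _ _))

/-- The square-zero extension functor. -/
noncomputable def sqZeroFunctor : TambaraModule.{u, v} B ⥤ (normsVanish φ).FullSubcategory where
  obj M := ⟨sqZeroGrp φ M, normsVanish_sqZeroGrp φ M⟩
  map {M N} g := ObjectProperty.homMk (InducedCategory.homMk
    (Grp.homMk (A := ⟨sqZeroAug φ M⟩) (B := ⟨sqZeroAug φ N⟩) (sqZeroAugMap φ g)))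
  map_id _ := rfl
  map_comp _ _ := rfl

end Augmented

/-! ### Two-colourings of the fibres of a map -/

namespace FinGSet

variable {G : Type u} [Group G]

section Fold

variable {X Y : FinGSet.{u} G} (f : X.Hom Y)

/-- The fold map `X ⊔ X → X`. -/
abbrev fold (X : FinGSet.{u} G) : (X.sum X).Hom X :=
  desc (MulActionHom.id G) (MulActionHom.id G)

/-- The `G`-set of points of `Y` together with a colouring of the fibre of `f` by two colours. -/
abbrev Coloring : FinGSet.{u} G := depProd (fold X) f

/-- The `G`-set of colourings with a chosen point of the fibre. -/
abbrev PointedColoring : FinGSet.{u} G := fiberProd f (depProdBase (fold X) f)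

variable {f}

/-- The chosen point has the second colour. -/
def IsMarked (z : PointedColoring f) : Prop := ∃ x : X, depProdEval (fold X) f z = inr X X x

theorem IsMarked.smul (γ : G) (z : PointedColoring f) (h : IsMarked z) : IsMarked (γ • z) := by
  obtain ⟨x, hx⟩ := h
  exact ⟨γ • x, by rw [map_smul, hx, ← map_smul]⟩

theorem IsMarked.not_smul (γ : G) (z : PointedColoring f) (h : ¬ IsMarked z) :
    ¬ IsMarked (γ • z) := fun h' => h (by
  have := IsMarked.smul γ⁻¹ _ h'
  rwa [inv_smul_smul] at this)

theorem IsMarked.eval_eq {z : PointedColoring f} (h : IsMarked z) :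
    depProdEval (fold X) f z = inr X X z.1.1 := by
  obtain ⟨x, hx⟩ := h
  have h1 := map_depProdEval (fold X) f z
  rw [hx] at h1
  rw [hx]
  exact congrArg (inr X X) h1

theorem eval_eq_of_not_isMarked {z : PointedColoring f} (h : ¬ IsMarked z) :
    depProdEval (fold X) f z = inl X X z.1.1 := by
  have h1 := map_depProdEval (fold X) f z
  generalize hy : depProdEval (fold X) f z = y at h1
  obtain x | x := y
  · exact congrArg (inl X X) h1
  · exact (h ⟨x, hy⟩).elim

variable (f)

/-- The colouring in the first colour. -/
def plainColoring : Y.Hom (Coloring f) where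
  toFun y :=
    { base := y
      sec := fun x _ => inl X X x
      isSection := fun _ _ => rfl : DepProdElt (fold X) f }
  map_smul' γ _ := DepProdElt.ext' rfl fun x _ _ => congrArg Sum.inl (smul_inv_smul γ x).symm

open Classical in
/-- The colouring with exactly one point of the second colour. -/
noncomputable def pointColoring : X.Hom (Coloring f) where
  toFun x :=
    { base := f x
      sec := fun x' _ => if x' = x then inr X X x' else inl X X x'
      isSection := fun x' _ => by split_ifs <;> rfl : DepProdElt (fold X) f }
  map_smul' γ x := by
    refine DepProdElt.ext' (map_smul f γ x) fun x' _ _ => ?_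
    change (if x' = γ • x then inr X X x' else inl X X x')
      = γ • (if γ⁻¹ • x' = x then inr X X (γ⁻¹ • x') else inl X X (γ⁻¹ • x'))
    simp only [inv_smul_eq_iff]
    split_ifs <;> rw [← map_smul, smul_inv_smul]

variable {f} in
/-- At least two points have the second colour. -/
def HasTwoMarked (s : Coloring f) : Prop :=
  ∃ z z' : PointedColoring f, z ≠ z' ∧ depProdSnd (fold X) f z = s ∧
    depProdSnd (fold X) f z' = s ∧ IsMarked z ∧ IsMarked z'

theorem HasTwoMarked.smul (γ : G) (s : Coloring f) (h : HasTwoMarked s) :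
    HasTwoMarked (γ • s) := by
  obtain ⟨z, z', hne, rfl, hz', hm, hm'⟩ := h
  refine ⟨γ • z, γ • z', fun h => hne (MulAction.injective γ h), map_smul _ γ z, ?_, hm.smul γ,
    hm'.smul γ⟩
  rw [map_smul, hz']

/-- The colourings with at least two points of the second colour. -/
def multiColoring : FinGSet.{u} G := (Coloring f).sub HasTwoMarked (HasTwoMarked.smul f)

/-- The inclusion of `multiColoring`. -/
def multiColoringIncl : (multiColoring f).Hom (Coloring f) := subIncl _ _ _

theorem not_isMarked_plainColoring {z : PointedColoring f} {y : Y}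
    (h : depProdSnd (fold X) f z = plainColoring f y) : ¬ IsMarked z := by
  obtain ⟨⟨x, s⟩, hz⟩ := z
  obtain rfl : s = plainColoring f y := h
  rintro ⟨x', hx'⟩
  exact Sum.inl_ne_inr hx'

theorem isMarked_pointColoring {z : PointedColoring f} {x : X}
    (h : depProdSnd (fold X) f z = pointColoring f x) : IsMarked z ↔ z.1.1 = x := by
  classical
  obtain ⟨⟨x', s⟩, hz⟩ := z
  obtain rfl : s = pointColoring f x := h
  constructor
  · rintro ⟨x₁, hx₁⟩
    by_contra hne
    exact Sum.inl_ne_inr ((if_neg hne).symm.trans hx₁)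
  · intro h
    exact ⟨x', if_pos h⟩

/-- The point of the second colour in `pointColoring`. -/
noncomputable def pointPointColoring (x : X) : PointedColoring f := ⟨(x, pointColoring f x), rfl⟩

theorem isMarked_pointPointColoring (x : X) : IsMarked (pointPointColoring f x) :=
  (isMarked_pointColoring f rfl).2 rfl

theorem injective_desc_pointColoring : Function.Injective
    (desc (pointColoring f) (multiColoringIncl f)) := by
  have key : ∀ (x : X) (s : multiColoring f), pointColoring f x ≠ multiColoringIncl f s := by
    rintro x ⟨s, z, z', hne, hz, hz', hm, hm'⟩ h
    obtain rfl : pointColoring f x = s := h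
    refine hne (Subtype.ext (Prod.ext ?_ (hz.trans hz'.symm)))
    rw [(isMarked_pointColoring f hz).1 hm, (isMarked_pointColoring f hz').1 hm']
  rintro (x | s) (x' | s') h
  · exact congrArg Sum.inl
      ((isMarked_pointColoring f (z := pointPointColoring f x) h).1
        (isMarked_pointPointColoring f x))
  · exact (key _ _ h).elim
  · exact (key _ _ h.symm).elim
  · exact congrArg Sum.inr (Subtype.ext h)

/-- A colouring has no point, exactly one point, or at least two points of the second colour. The
three cases are parametrised by `Y`, `X` and `multiColoring f`, and correspond to the terms of
degree zero, one and at least two in `N_f(a + r)`. -/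
theorem isDisjointCover_coloring :
    IsDisjointCover (plainColoring f) (desc (pointColoring f) (multiColoringIncl f)) where
  injective_left y y' h := congrArg DepProdElt.base h
  injective_right := injective_desc_pointColoring f
  ne y := by
    rintro (x | ⟨s, z, z', hne, hz, hz', hm, hm'⟩) h
    · exact not_isMarked_plainColoring f (z := pointPointColoring f x) h.symm
        (isMarked_pointPointColoring f x)
    · exact not_isMarked_plainColoring f (hz.trans h.symm) hm
  cover s := by
    classical
    by_cases h2 : HasTwoMarked s
    · exact Or.inr ⟨Sum.inr ⟨s, h2⟩, rfl⟩
    by_cases h1 : ∃ z : PointedColoring f, depProdSnd (fold X) f z = s ∧ IsMarked z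
    · obtain ⟨z, rfl, hm⟩ := h1
      -- With `z` marked and no second marked point, every other point of the fibre has the first
      -- colour, so the colouring is the one attached to the underlying point of `z`.
      refine Or.inr ⟨Sum.inl z.1.1, DepProdElt.ext' z.2 fun x _ hx => ?_⟩
      let z' : PointedColoring f := ⟨(x, z.1.2), hx⟩
      change (if x = z.1.1 then inr X X x else inl X X x) = depProdEval (fold X) f z'
      split_ifs with hxz
      · have e : z = z' := Subtype.ext (Prod.ext hxz.symm rfl)
        rw [← e, hm.eval_eq, hxz]
      · refine (eval_eq_of_not_isMarked (z := z') fun hm' => h2 ⟨z, z', ?_, rfl, rfl, hm, hm'⟩).symm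
        exact fun h => hxz (congrArg (fun z => z.1.1) h).symm
    · refine Or.inl ⟨DepProdElt.base s, DepProdElt.ext' rfl fun x _ hx => ?_⟩
      exact (eval_eq_of_not_isMarked (z := ⟨(x, s), hx⟩) fun hm => h1 ⟨_, rfl, hm⟩).symm

/-- The map `x ↦ (x, plainColoring (f x))`. -/
def plainColoringLift : X.Hom (PointedColoring f) where
  toFun x := ⟨(x, plainColoring f (f x)), rfl⟩
  map_smul' γ x := Subtype.ext (Prod.ext rfl (by
    change plainColoring f (f (γ • x)) = γ • plainColoring f (f x)
    rw [map_smul, map_smul]))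

/-- Restricting the universal norm to the plain colourings gives back a norm along `f` itself. -/
theorem isCartesian_plainColoringLift :
    IsCartesian (plainColoringLift f) f (depProdSnd (fold X) f) (plainColoring f) where
  comm _ := rfl
  existsUnique z y h := by
    obtain ⟨⟨x, s⟩, hz⟩ := z
    obtain rfl : s = plainColoring f y := h
    obtain rfl : f x = y := hz
    exact ⟨x, ⟨rfl, rfl⟩, fun _ h => congrArg (fun z => z.1.1) h.1⟩

/-- The map `(x, x') ↦ (x', pointColoring x)`. -/
noncomputable def pointColoringLift : (fiberProd f f).Hom (PointedColoring f) where
  toFun p := ⟨(p.1.2, pointColoring f p.1.1), Eq.symm p.2⟩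
  map_smul' γ p := Subtype.ext (Prod.ext rfl (map_smul (pointColoring f) γ p.1.1))

/-- Over the colouring that marks `x`, the points of the fibre are the pairs `(x, x')`; the marked
one is the diagonal. -/
theorem isCartesian_pointColoringLift :
    IsCartesian (pointColoringLift f) (FinGSet.fiberProdFst f f) (depProdSnd (fold X) f)
      (pointColoring f) where
  comm _ := rfl
  existsUnique z x h := by
    obtain ⟨⟨x', s⟩, hz⟩ := z
    obtain rfl : s = pointColoring f x := h
    refine ⟨⟨(x, x'), Eq.symm hz⟩, ⟨rfl, rfl⟩, fun _ h => Subtype.ext (Prod.ext h.2 ?_)⟩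
    exact congrArg (fun z => z.1.1) h.1

/-- The `G`-set of points of the second colour of the elements of `multiColoring`. -/
def markedPoints : FinGSet.{u} G :=
  (fiberProd (depProdSnd (fold X) f) (multiColoringIncl f)).sub (fun w => IsMarked w.1.1)
    (fun γ w h => IsMarked.smul γ w.1.1 h)

/-- The complement of `markedPoints`. -/
def unmarkedPoints : FinGSet.{u} G :=
  (fiberProd (depProdSnd (fold X) f) (multiColoringIncl f)).sub (fun w => ¬ IsMarked w.1.1)
    (fun γ w h => IsMarked.not_smul γ w.1.1 h)

/-- The inclusion of `markedPoints`. -/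
def markedPointsIncl :
    (markedPoints f).Hom (fiberProd (depProdSnd (fold X) f) (multiColoringIncl f)) :=
  subIncl _ _ _

/-- The inclusion of `unmarkedPoints`. -/
def unmarkedPointsIncl :
    (unmarkedPoints f).Hom (fiberProd (depProdSnd (fold X) f) (multiColoringIncl f)) :=
  subIncl _ _ _

theorem isDisjointCover_markedPoints :
    IsDisjointCover (markedPointsIncl f) (unmarkedPointsIncl f) :=
  isDisjointCover_sub _ _ _ _

/-- The projection `markedPoints → multiColoring`. -/
def markedPointsProj : (markedPoints f).Hom (multiColoring f) where
  toFun w := w.1.1.2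
  map_smul' _ _ := rfl

/-- The projection `markedPoints → X`. -/
def markedPointsFst : (markedPoints f).Hom X where
  toFun w := w.1.1.1.1.1
  map_smul' _ _ := rfl

/-- This is where the vanishing hypothesis on norms enters: the points of the second colour in
`multiColoring` form a 2-surjective map. -/
theorem twoSurjective_markedPointsProj : TwoSurjective (markedPointsProj f) := by
  intro s
  obtain ⟨z, z', hne, hz, hz', hm, hm'⟩ := s.2
  exact ⟨⟨⟨(z, s), hz⟩, hm⟩, rfl, ⟨⟨(z', s), hz'⟩, hm'⟩, rfl,
    fun h => hne (congrArg (fun w => w.1.1.1) h)⟩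

end Fold

end FinGSet

/-! ### The norm of a sum, modulo higher-order terms -/

namespace TambaraFunctor

variable {G : Type u} [Group G] [Finite G] {O : IndexingSystem.{u} G} (R : TambaraFunctor.{u, v} O)

/-- If the norms of the restrictions of `r` along 2-surjective maps vanish, then `N_f(a + r)` only
involves the terms of degree at most one in `r`. -/
theorem nm_add {X Y : FinGSet.{u} G} (f : X.Hom Y) (hf : O.Admissible f) (a r : R.obj X)
    (hr : ∀ {U Z : FinGSet.{u} G} (i : U.Hom X) (k : U.Hom Z) (hk : O.Admissible k),
      TwoSurjective k → R.nm k hk (R.res i r) = 0) :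
    R.nm f hf (a + r) = R.nm f hf a + R.tr f (R.cofactor f hf a * r) := by
  classical
  -- `c` is the element of `R(X ⊔ X)` that is `a` on the first colour and `r` on the second.
  obtain ⟨c, hc⟩ := (R.bijective_sum X X).2 (a, r)
  have ha : R.res (inl X X) c = a := congrArg Prod.fst hc
  have hr' : R.res (inr X X) c = r := congrArg Prod.snd hc
  have hsum : a + r = R.tr (fold X) c := by
    rw [R.tr_eq_add (isDisjointCover_sum X X) (fold X) (MulActionHom.id G) (MulActionHom.id G)
      (fun _ => rfl) fun _ => rfl, ha, hr', R.tr_id, R.tr_id]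
  have hg := hf.depProdSnd (fold X)
  -- No point of the second colour: only `a` is multiplied.
  have h0 : R.res (plainColoring f) (R.nm _ hg (R.res (depProdEval (fold X) f) c))
      = R.nm f hf a := by
    rw [R.res_nm _ _ _ _ (isCartesian_plainColoringLift f),
      R.res_res _ _ (inl X X) fun _ => rfl, ha]
  -- One point of the second colour: the diagonal of `X ×_Y X` contributes `r`, its complement the
  -- product of `a` over the other points.
  have h1 : R.res (pointColoring f) (R.nm _ hg (R.res (depProdEval (fold X) f) c))
      = R.cofactor f hf a * r := by
    rw [R.res_nm _ _ _ _ (isCartesian_pointColoringLift f), ← R.res_comp (pointColoringLift f),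
      R.nm_eq_mul (isDisjointCover_diag f) _ _ (MulActionHom.id G) (offDiagFst f) (fun _ => rfl)
        (fun _ => rfl) (O.admissible_id X) hf.offDiagFst, R.nm_id, mul_comm,
      R.res_res (diag f) _ (inr X X) fun _ => if_pos rfl, hr',
      R.res_res_comm (offDiagIncl f) _ (offDiagSnd f) (inl X X) fun p => if_neg p.2.2.symm, ha]
    rfl
  -- Two or more points of the second colour: the norm splits over marked and unmarked points, and
  -- the marked factor is a norm of a restriction of `r` along a 2-surjective map.
  have h2 : R.res (multiColoringIncl f) (R.nm _ hg (R.res (depProdEval (fold X) f) c)) = 0 := by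
    have hc2 := isCartesian_fiberProd (depProdSnd (fold X) f) (multiColoringIncl f)
    have hq := hg.of_isCartesian hc2
    have hcov := isDisjointCover_markedPoints f
    have hU : O.Admissible (markedPointsProj f) :=
      (hq.comp (O.admissible_of_injective _ hcov.injective_left)).congr fun _ => rfl
    have hV := hq.comp (O.admissible_of_injective _ hcov.injective_right)
    rw [R.res_nm _ _ _ _ hc2, ← R.res_comp (FinGSet.fiberProdFst _ _),
      R.nm_eq_mul hcov _ hq (markedPointsProj f) _ (fun _ => rfl) (fun _ => rfl) hU hV,
      R.res_res_comm (markedPointsIncl f) _ (markedPointsFst f) (inr X X)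
        fun w => IsMarked.eval_eq w.2, hr',
      hr _ _ _ (twoSurjective_markedPointsProj f), zero_mul]
  -- The transfer to `Y` splits over the three kinds of colourings; the base map is the identity on
  -- the plain ones and `f` on those with one marked point.
  rw [hsum, R.nm_tr, R.tr_eq_add (isDisjointCover_coloring f) _ (MulActionHom.id G)
      (desc f (MulActionHom.comp (depProdBase (fold X) f) (multiColoringIncl f))) (fun _ => rfl)
      (by rintro (_ | _) <;> rfl), R.tr_id, h0,
    R.tr_eq_add (isDisjointCover_sum X (multiColoring f)) _ f
      (MulActionHom.comp (depProdBase (fold X) f) (multiColoringIncl f)) (fun _ => rfl)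
      (fun _ => rfl), R.res_res _ _ (pointColoring f) fun _ => rfl, h1,
    R.res_res _ _ (multiColoringIncl f) fun _ => rfl, h2, map_zero, add_zero]

end TambaraFunctor

/-! ### Maps of Tambara functors: cofactors and levelwise isomorphisms -/

namespace TambaraFunctor

variable {G : Type u} [Group G] [Finite G] {O : IndexingSystem.{u} G}

theorem Hom.app_cofactor {R S : TambaraFunctor.{u, v} O} (α : R ⟶ S) {X Y : FinGSet.{u} G}
    (f : X.Hom Y) (hf : O.Admissible f) (b : R.obj X) :
    app α X (R.cofactor f hf b) = S.cofactor f hf (app α X b) := by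
  rw [cofactor_apply, cofactor_apply, Hom.app_nm, Hom.app_res]

/-- A levelwise bijective map of Tambara functors is an isomorphism. -/
theorem isIso_of_bijective {R S : TambaraFunctor.{u, v} O} (α : R ⟶ S)
    (h : ∀ X, Function.Bijective (app α X)) : IsIso α := by
  let e (X : FinGSet.{u} G) : R.obj X ≃+* S.obj X := RingEquiv.ofBijective (app α X) (h X)
  have he (X : FinGSet.{u} G) (s : S.obj X) : app α X ((e X).symm s) = s :=
    (e X).apply_symm_apply s
  let β : S ⟶ R :=
    { app := fun X => (e X).symm
      app_res := fun {X Y} f a => (h X).1 (by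
        rw [Hom.app_res]
        exact (he X _).trans (congrArg (S.res f) (he Y a).symm))
      app_tr := fun {X Y} f a => (h Y).1 (by
        rw [Hom.app_tr]
        exact (he Y _).trans (congrArg (S.tr f) (he X a).symm))
      app_nm := fun {X Y} f hf a => (h Y).1 (by
        rw [Hom.app_nm]
        exact (he Y _).trans (congrArg (S.nm f hf) (he X a).symm)) }
  exact ⟨β, hom_ext fun X a => (e X).symm_apply_apply a, hom_ext fun X a => he X a⟩

end TambaraFunctor

/-! ### The structure of abelian group objects -/

section Augmented

open MonoidalCategory CartesianMonoidalCategory MonObj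

variable {G : Type u} [Group G] [Finite G] {O : IndexingSystem.{u} G}
  {A B : TambaraFunctor.{u, v} O} {φ : A ⟶ B}

namespace AugCAlg

theorem isIso_of_bijective {R S : AugCAlg φ} (f : R ⟶ S)
    (h : ∀ X, Function.Bijective (TambaraFunctor.app (homTambara f) X)) : IsIso f := by
  have : IsIso ((Over.forget _ ⋙ Under.forget _).map f) :=
    TambaraFunctor.isIso_of_bijective (homTambara f) h
  exact isIso_of_reflects_iso f (Over.forget _ ⋙ Under.forget _)

variable (R : CommGrp (AugCAlg φ))

theorem alg_unit : φ ≫ unit R = R.X.alg :=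
  alg_hom (R := 𝟙_ (AugCAlg φ)) η[R.X]

theorem aug_unit (X : FinGSet.{u} G) (b : B.obj X) :
    TambaraFunctor.app R.X.aug X (TambaraFunctor.app (unit R) X b) = b :=
  congrArg (fun z => TambaraFunctor.app z X b) (hom_aug (R := 𝟙_ (AugCAlg φ)) η[R.X])

/-- The fibre product condition gives `ε(r) = b`, so `(r, b)` is an element of `R ×_B B`. Its image
under `id ⊗ η` is `z`, and the right unit law applies. -/
theorem mul_unit_right (X : FinGSet.{u} G) (z : (R.X ⊗ R.X).toTambara.obj X) (b : B.obj X)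
    (h : z.1.2 = TambaraFunctor.app (unit R) X b) :
    TambaraFunctor.app (homTambara μ[R.X]) X z = z.1.1 := by
  obtain ⟨⟨r, s⟩, hrs⟩ := z
  obtain rfl : s = TambaraFunctor.app (unit R) X b := h
  have hb : TambaraFunctor.app R.X.aug X r = b :=
    Eq.trans hrs (aug_unit R X b)
  exact congrArg (fun f => TambaraFunctor.app (homTambara f) X
    (⟨(r, b), hb⟩ : (R.X ⊗ 𝟙_ (AugCAlg φ)).toTambara.obj X)) (MonObj.mul_one R.X)

theorem mul_unit_left (X : FinGSet.{u} G) (z : (R.X ⊗ R.X).toTambara.obj X) (b : B.obj X)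
    (h : z.1.1 = TambaraFunctor.app (unit R) X b) :
    TambaraFunctor.app (homTambara μ[R.X]) X z = z.1.2 := by
  obtain ⟨⟨r, s⟩, hrs⟩ := z
  obtain rfl : r = TambaraFunctor.app (unit R) X b := h
  have hb : b = TambaraFunctor.app R.X.aug X s :=
    (aug_unit R X b).symm.trans hrs
  exact congrArg (fun f => TambaraFunctor.app (homTambara f) X
    (⟨(b, s), hb⟩ : (𝟙_ (AugCAlg φ) ⊗ R.X).toTambara.obj X)) (MonObj.one_mul R.X)

/-- The addition of an abelian group object is `(r, s) ↦ r + s - η(ε(r))`. -/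
theorem mul_apply (X : FinGSet.{u} G) (z : (R.X ⊗ R.X).toTambara.obj X) :
    TambaraFunctor.app (homTambara μ[R.X]) X z = z.1.1 + z.1.2 -
      TambaraFunctor.app (unit R) X (TambaraFunctor.app R.X.aug X z.1.1) := by
  obtain ⟨⟨r, s⟩, hrs⟩ := z
  have hrs : TambaraFunctor.app R.X.aug X r = TambaraFunctor.app R.X.aug X s := hrs
  set b := TambaraFunctor.app R.X.aug X r
  have hb := aug_unit R X b
  let z₁ : (R.X ⊗ R.X).toTambara.obj X := ⟨(r, TambaraFunctor.app (unit R) X b), hb.symm⟩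
  let z₂ : (R.X ⊗ R.X).toTambara.obj X := ⟨(TambaraFunctor.app (unit R) X b, s), hb.trans hrs⟩
  let z₃ : (R.X ⊗ R.X).toTambara.obj X :=
    ⟨(TambaraFunctor.app (unit R) X b, TambaraFunctor.app (unit R) X b), rfl⟩
  -- `(r, s) = (r, η(b)) + (η(b), s) - (η(b), η(b))`, where the unit laws evaluate `μ` on each term.
  have hz : (⟨(r, s), hrs⟩ : (R.X ⊗ R.X).toTambara.obj X) = z₁ + z₂ - z₃ :=
    Subtype.ext (Prod.ext (add_sub_cancel_right _ _).symm (add_sub_cancel_left _ _).symm)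
  change TambaraFunctor.app (homTambara μ[R.X]) X ⟨(r, s), hrs⟩ =
    r + s - TambaraFunctor.app (unit R) X b
  rw [hz, map_sub, map_add, mul_unit_right R X z₁ b rfl, mul_unit_left R X z₂ b rfl,
    mul_unit_left R X z₃ b rfl]

/-- The augmentation ideal of an abelian group object has square zero. -/
theorem mul_eq_zero_of_mem_ker (X : FinGSet.{u} G) {r s : R.X.toTambara.obj X}
    (hr : r ∈ R.X.ker X) (hs : s ∈ R.X.ker X) : r * s = 0 := by
  have hr := RingHom.mem_ker.1 hr
  have hs := RingHom.mem_ker.1 hs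
  let z₁ : (R.X ⊗ R.X).toTambara.obj X := ⟨(r, 0),
    hr.trans (map_zero (TambaraFunctor.app R.X.aug X)).symm⟩
  let z₂ : (R.X ⊗ R.X).toTambara.obj X := ⟨(0, s),
    (map_zero (TambaraFunctor.app R.X.aug X)).trans hs.symm⟩
  -- `(r, 0)` and `(0, s)` lie in the fibre product because `r` and `s` are in the kernel. As `0 =
  -- η(0)`, the unit laws show that `μ` maps them to `r` and `s`.
  have h0 : z₁ * z₂ = 0 := Subtype.ext (Prod.ext (mul_zero _) (zero_mul _))
  have h := congrArg (TambaraFunctor.app (homTambara μ[R.X]) X) h0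
  rwa [map_zero, map_mul, mul_unit_right R X z₁ 0 (map_zero _).symm,
    mul_unit_left R X z₂ 0 (map_zero _).symm] at h

end AugCAlg

/-! ### Reconstruction of `R` from its augmentation ideal -/

/-- The comparison map `B ⋉ ker(R → B) → R`, `(b, r) ↦ η(b) + r`. -/
noncomputable def sqZeroCounitHom (R : CommGrp (AugCAlg φ)) (hR : normsVanish φ R) :
    sqZeroTambara (augIdealObj R) ⟶ R.X.toTambara where
  app X :=
    { toFun := fun (x : SqZero (augIdealObj R) X) =>
        TambaraFunctor.app (AugCAlg.unit R) X x.base + (show R.X.ker X from x.val).1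
      map_one' := (add_zero _).trans (map_one _)
      map_mul' := by
        rintro ⟨b, ⟨r, hr⟩⟩ ⟨c, ⟨s, hs⟩⟩
        change TambaraFunctor.app (AugCAlg.unit R) X (b * c) +
          (TambaraFunctor.app (AugCAlg.unit R) X b * s + TambaraFunctor.app (AugCAlg.unit R) X c * r)
          = (TambaraFunctor.app (AugCAlg.unit R) X b + r) *
            (TambaraFunctor.app (AugCAlg.unit R) X c + s)
        rw [map_mul, add_mul, mul_add, mul_add, AugCAlg.mul_eq_zero_of_mem_ker R X hr hs]
        ring
      map_zero' := (add_zero _).trans (map_zero _)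
      map_add' := by
        rintro ⟨b, ⟨r, hr⟩⟩ ⟨c, ⟨s, hs⟩⟩
        change TambaraFunctor.app (AugCAlg.unit R) X (b + c) + (r + s) = _
        rw [map_add]
        exact add_add_add_comm _ _ _ _ }
  app_res {X Y} f := by
    rintro ⟨b, ⟨r, hr⟩⟩
    change TambaraFunctor.app (AugCAlg.unit R) X (B.res f b) + R.X.toTambara.res f r
      = R.X.toTambara.res f (TambaraFunctor.app (AugCAlg.unit R) Y b + r)
    rw [map_add, TambaraFunctor.Hom.app_res]
  app_tr {X Y} f := by
    rintro ⟨b, ⟨r, hr⟩⟩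
    change TambaraFunctor.app (AugCAlg.unit R) Y (B.tr f b) + R.X.toTambara.tr f r
      = R.X.toTambara.tr f (TambaraFunctor.app (AugCAlg.unit R) X b + r)
    rw [map_add, TambaraFunctor.Hom.app_tr]
  app_nm {X Y} f hf := by
    rintro ⟨b, ⟨r, hr⟩⟩
    change TambaraFunctor.app (AugCAlg.unit R) Y (B.nm f hf b) + R.X.toTambara.tr f
        (TambaraFunctor.app (AugCAlg.unit R) X (B.cofactor f hf b) * r)
      = R.X.toTambara.nm f hf (TambaraFunctor.app (AugCAlg.unit R) X b + r)
    -- The expansion of the norm applies since the augmentation ideal is stable under restrictions,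
    -- so the vanishing condition covers every restriction of `r`.
    rw [TambaraFunctor.nm_add, TambaraFunctor.Hom.app_nm, TambaraFunctor.Hom.app_cofactor]
    intro U Z i k hk h2
    refine hR k hk h2 _ (RingHom.mem_ker.2 ?_)
    rw [TambaraFunctor.Hom.app_res, RingHom.mem_ker.1 hr, map_zero]

theorem sqZeroCounitHom_apply (R : CommGrp (AugCAlg φ)) (hR : normsVanish φ R) (X : FinGSet.{u} G)
    (b : B.obj X) (r : R.X.ker X) :
    TambaraFunctor.app (sqZeroCounitHom R hR) X (⟨b, r⟩ : SqZero (augIdealObj R) X) =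
      TambaraFunctor.app (AugCAlg.unit R) X b + r.1 :=
  rfl

theorem aug_sqZeroCounitHom (R : CommGrp (AugCAlg φ)) (hR : normsVanish φ R) (X : FinGSet.{u} G)
    (x : SqZero (augIdealObj R) X) :
    TambaraFunctor.app R.X.aug X (TambaraFunctor.app (sqZeroCounitHom R hR) X x) = x.base := by
  obtain ⟨b, r⟩ := x
  rw [sqZeroCounitHom_apply R hR X b r, map_add, AugCAlg.aug_unit, RingHom.mem_ker.1 r.2, add_zero]

/-- Since `η` splits `ε`, every `r` is uniquely `η(ε(r))` plus an element of the kernel. -/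
theorem bijective_sqZeroCounitHom (R : CommGrp (AugCAlg φ)) (hR : normsVanish φ R)
    (X : FinGSet.{u} G) :
    Function.Bijective (TambaraFunctor.app (sqZeroCounitHom R hR) X) := by
  constructor
  · intro x y h
    have hb : x.base = y.base := (aug_sqZeroCounitHom R hR X x).symm.trans
      ((congrArg (TambaraFunctor.app R.X.aug X) h).trans (aug_sqZeroCounitHom R hR X y))
    obtain ⟨b, r⟩ := x
    obtain ⟨c, s⟩ := y
    obtain rfl : b = c := hb
    rw [sqZeroCounitHom_apply R hR X b r, sqZeroCounitHom_apply R hR X b s] at h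
    exact SqZero.ext rfl (Subtype.ext (add_left_cancel h))
  · intro r
    let b := TambaraFunctor.app R.X.aug X r
    have hr : r - TambaraFunctor.app (AugCAlg.unit R) X b ∈ R.X.ker X := by
      rw [RingHom.mem_ker, map_sub, AugCAlg.aug_unit, sub_self]
    exact ⟨⟨b, ⟨_, hr⟩⟩, add_sub_cancel _ _⟩

/-- The comparison map `B ⋉ ker(R → B) → R` in `A-CAlg/B`. -/
noncomputable def sqZeroCounitAug (R : CommGrp (AugCAlg φ)) (hR : normsVanish φ R) :
    sqZeroAug φ (augIdealObj R) ⟶ R.X :=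
  AugCAlg.homMk (R := sqZeroAug φ (augIdealObj R)) (S := R.X) (sqZeroCounitHom R hR)
    (TambaraFunctor.hom_ext fun X a => (add_zero _).trans
      (congrArg (fun z => TambaraFunctor.app z X a) (AugCAlg.alg_unit R)))
    (TambaraFunctor.hom_ext fun X x => aug_sqZeroCounitHom R hR X x)

theorem one_sqZeroCounitAug (R : CommGrp (AugCAlg φ)) (hR : normsVanish φ R) :
    η[sqZeroAug φ (augIdealObj R)] ≫ sqZeroCounitAug R hR = η[R.X] :=
  AugCAlg.hom_ext (TambaraFunctor.hom_ext fun _ _ => add_zero _)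

/-- By `AugCAlg.mul_apply` the group law of `R` is expressed through `+` and `η`; compatibility is
then `η(b) + (r + s) = (η(b) + r) + (η(b) + s) - η(b)`. -/
theorem mul_sqZeroCounitAug (R : CommGrp (AugCAlg φ)) (hR : normsVanish φ R) :
    μ[sqZeroAug φ (augIdealObj R)] ≫ sqZeroCounitAug R hR =
      (sqZeroCounitAug R hR ⊗ₘ sqZeroCounitAug R hR) ≫ μ[R.X] :=
  AugCAlg.hom_ext (TambaraFunctor.hom_ext fun X z => by
    refine Eq.trans ?_ (AugCAlg.mul_apply R X
      (TambaraFunctor.app (AugCAlg.homTambara (sqZeroCounitAug R hR ⊗ₘ sqZeroCounitAug R hR)) X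
        z)).symm
    obtain ⟨⟨⟨b, r⟩, ⟨c, s⟩⟩, h⟩ := z
    obtain rfl : b = c := h
    change TambaraFunctor.app (AugCAlg.unit R) X b + (r.1 + s.1) =
      (TambaraFunctor.app (AugCAlg.unit R) X b + r.1) +
        (TambaraFunctor.app (AugCAlg.unit R) X b + s.1) - TambaraFunctor.app (AugCAlg.unit R) X
        (TambaraFunctor.app R.X.aug X (TambaraFunctor.app (sqZeroCounitHom R hR) X
          (⟨b, r⟩ : SqZero (augIdealObj R) X)))
    rw [aug_sqZeroCounitHom]
    ring)

/-- The isomorphism `B ⋉ ker(R → B) ≅ R` of abelian group objects. -/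
noncomputable def sqZeroCounitIso (R : CommGrp (AugCAlg φ)) (hR : normsVanish φ R) :
    sqZeroGrp φ (augIdealObj R) ≅ R :=
  haveI : IsIso (sqZeroCounitAug R hR) :=
    AugCAlg.isIso_of_bijective _ (bijective_sqZeroCounitHom R hR)
  let e : sqZeroAug φ (augIdealObj R) ≅ R.X := asIso (sqZeroCounitAug R hR)
  CommGrp.mkIso (G := sqZeroGrp φ (augIdealObj R)) e
    (one_sqZeroCounitAug R hR) (mul_sqZeroCounitAug R hR)

theorem sqZeroCounitAug_naturality {R S : CommGrp (AugCAlg φ)} (hR : normsVanish φ R)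
    (hS : normsVanish φ S) (f : R ⟶ S) :
    sqZeroAugMap φ ((augIdeal φ).map f) ≫ sqZeroCounitAug S hS =
      sqZeroCounitAug R hR ≫ f.hom.hom.hom :=
  AugCAlg.hom_ext (TambaraFunctor.hom_ext fun X x => by
    obtain ⟨b, ⟨r, hr⟩⟩ := x
    change TambaraFunctor.app (AugCAlg.unit S) X b +
        TambaraFunctor.app (AugCAlg.homTambara f.hom.hom.hom) X r =
      TambaraFunctor.app (AugCAlg.homTambara f.hom.hom.hom) X
        (TambaraFunctor.app (AugCAlg.unit R) X b + r)
    rw [map_add, ← AugCAlg.unit_hom f]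
    rfl)

/-! ### The equivalence of categories -/

variable (φ) in
/-- The square-zero extension of the augmentation ideal of `R` is `R`. -/
noncomputable def sqZeroCounit : ((normsVanish φ).ι ⋙ augIdeal φ) ⋙ sqZeroFunctor φ ≅
    𝟭 (normsVanish φ).FullSubcategory :=
  NatIso.ofComponents
    (fun R => ObjectProperty.isoMk _ (sqZeroCounitIso R.obj R.property))
    (fun {R S} f => ObjectProperty.hom_ext _ (CommGrp.hom_ext _ _
      (sqZeroCounitAug_naturality R.property S.property f.hom)))

variable (φ) in
/-- The augmentation ideal of `B ⋉ M` is `M`. -/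
noncomputable def augIdealSqZeroIso (M : TambaraModule.{u, v} B) :
    augIdealObj (sqZeroGrp φ M) ≅ M where
  hom :=
    { app := fun X =>
        { toFun := fun (x : (sqZeroAug φ M).ker X) => (show SqZero M X from x.1).val
          map_add' := fun _ _ => rfl
          map_smul' := fun b (x : (sqZeroAug φ M).ker X) => by
            -- `B` acts on the kernel through multiplication by `η(b) = (b, 0)`, whose module
            -- component contributes nothing.
            change b • (show SqZero M X from x.1).val +
              (show SqZero M X from x.1).base • (0 : M.obj X) = _
            rw [smul_zero, add_zero]
            rfl }
      app_res := fun _ _ => rfl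
      app_tr := fun _ _ => rfl }
  inv :=
    { app := fun X =>
        { toFun := fun m => show (sqZeroAug φ M).ker X from ⟨(⟨0, m⟩ : SqZero M X), rfl⟩
          map_add' := fun m n => Subtype.ext (SqZero.ext (add_zero (0 : B.obj X)).symm rfl)
          map_smul' := fun b m => Subtype.ext (SqZero.ext (mul_zero b).symm (by
            change b • m = b • m + (0 : B.obj X) • (0 : M.obj X)
            rw [smul_zero, add_zero])) }
      app_res := fun f _ => Subtype.ext (SqZero.ext (map_zero (B.res f)).symm rfl)
      app_tr := fun f _ => Subtype.ext (SqZero.ext (map_zero (B.tr f)).symm rfl) }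
  hom_inv_id := TambaraModule.hom_ext fun X (x : (sqZeroAug φ M).ker X) =>
    Subtype.ext (SqZero.ext (RingHom.mem_ker.1 x.2).symm rfl)
  inv_hom_id := rfl

variable (φ) in
/-- The equivalence between the abelian group objects with vanishing norms and the modules. -/
noncomputable def augIdealEquivalence :
    (normsVanish φ).FullSubcategory ≌ TambaraModule.{u, v} B :=
  -- The isomorphism `B ⋉ I ≅ R` is the inverse of the unit, because the augmentation ideal functor
  -- is the forward direction.
  CategoryTheory.Equivalence.mk ((normsVanish φ).ι ⋙ augIdeal φ) (sqZeroFunctor φ)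
    (sqZeroCounit φ).symm (NatIso.ofComponents (augIdealSqZeroIso φ) fun _ => rfl)

variable (φ) in
/-- The square-zero extension functor is given by the formulas for `B ⋉ M`. -/
noncomputable def sqZeroFunctorIso : SqZeroFunctorIso (sqZeroFunctor φ ⋙ (normsVanish φ).ι) where
  iso M :=
    { coord := fun X =>
        { toFun := fun x : SqZero M X => (x.base, x.val)
          invFun := fun x => (⟨x.1, x.2⟩ : SqZero M X)
          left_inv := fun _ => rfl
          right_inv := fun _ => rfl }
      coord_add := fun _ _ _ => rfl
      coord_one := fun _ => rfl
      coord_mul := fun _ _ _ => rfl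
      coord_res := fun _ _ => rfl
      coord_tr := fun _ _ => rfl
      coord_nm := fun _ _ _ => rfl
      coord_alg := fun _ _ => rfl
      aug_eq := fun _ _ => rfl
      coord_unit := fun _ _ => rfl
      coord_groupAdd := fun _ _ => rfl
      coord_groupInv := fun _ _ => rfl }
  coord_map _ _ _ := rfl

end Augmented

/-- The category of abelian group objects of `A-CAlg/B` whose augmentation ideal has vanishing norms
for all 2-surjective admissible maps is equivalent to the category of `B`-modules, through the
augmentation ideal functor, with inverse the square-zero extension functor. -/
theorem mainTheorem1 {G : Type u} [Group G] [Finite G] (O : IndexingSystem.{u} G)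
    {A B : TambaraFunctor.{u, v} O} (φ : A ⟶ B) :
    ∃ e : (normsVanish φ).FullSubcategory ≌ TambaraModule.{u, v} B,
      e.functor = (normsVanish φ).ι ⋙ augIdeal φ ∧
        Nonempty (SqZeroFunctorIso (e.inverse ⋙ (normsVanish φ).ι)) :=
  ⟨augIdealEquivalence φ, rfl, ⟨sqZeroFunctorIso φ⟩⟩
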